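/- **Hilbert 90 for perfect complexes.** Two complexes in an abelian category are called *quasi-isomorphic* if they are isomorphic in its derived category. A complex of modules over a commutative ring is *strictly perfect* if it is bounded and all its terms are finitely generated projective modules. A complex of $\mathcal O_X$-modules on a scheme $X$ is *perfect* if, locally on $X$, it admits a quasi-isomorphism from a bounded complex of finite free $\mathcal O$-modules. (1) Local form. Let $(R,\mathfrak m)$ be a Noetherian local ring with infinite residue field $R/\mathfrak m$, let $R\to S$ be a faithfully flat homomorphism of commutative rings, and let $P^\bullet$, $Q^\bullet$ be strictly perfect complexes over $R$. If $P^\bullet\otimes_R S$ and $Q^\bullet\otimes_R S$ are quasi-isomorphic over $S$, then $P^\bullet$ and $Q^\bullet$ are quasi-isomorphic over $R$. (2) Scheme form. Let $X$ be a Noetherian scheme all of whose residue fields $\kappa(x)$, $x\in X$, are infinite, let $E$ be a perfect complex on $X$, and let $F$ be a complex of $\mathcal O_X$-modules. If $F$ is an fppf-form of $E$, i.e. there is an fppf covering $\{f_i:U_i\to X\}$ (a jointly surjective family of flat morphisms locally of finite presentation) such that $f_i^*E$ and $f_i^*F$ are quasi-isomorphic on $U_i$ for all $i$, then $F$ is a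 Zariski form of $E$, i.e. there is a covering $\{g_j:V_j\to X\}$ of $X$ by open immersions such that $g_j^*E$ and $g_j^*F$ are quasi-isomorphic on $V_j$ for all $j$. -/

import Mathlib

open CategoryTheory AlgebraicGeometry

universe u v w

noncomputable section

/-- Two cochain complexes in an abelian category are quasi-isomorphic if they are isomorphic in
the derived category, i.e. if they are connected by a zigzag of quasi-isomorphisms. -/
def QuasiIsomorphic {C : Type u} [Category.{v} C] [Abelian C] (K L : CochainComplex C ℤ) : Prop :=
  letI : HasDerivedCategory C := HasDerivedCategory.standard C
  Nonempty (DerivedCategory.Q.obj K ≅ DerivedCategory.Q.obj L)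

/-- A cochain complex is bounded if its terms vanish outside some interval `[a, b]`. -/
def IsBoundedComplex {C : Type u} [Category.{v} C] [Abelian C] (K : CochainComplex C ℤ) : Prop :=
  ∃ a b : ℤ, K.IsStrictlyGE a ∧ K.IsStrictlyLE b

section Rings

/-- A complex of `R`-modules is strictly perfect if it is bounded and all its terms are finitely
generated projective modules. -/
def IsStrictlyPerfect {R : Type u} [CommRing R] (P : CochainComplex (ModuleCat.{w} R) ℤ) : Prop :=
  IsBoundedComplex P ∧ ∀ i : ℤ, Module.Finite R (P.X i) ∧ Module.Projective R (P.X i)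

instance extendScalars_additive {R : Type u} {S : Type v} [CommRing R] [CommRing S] (φ : R →+* S) :
    (ModuleCat.extendScalars.{u, v, w} φ).Additive where
  map_add {M N f g} := by
    let _ : Algebra R S := φ.toAlgebra
    apply ModuleCat.hom_ext
    exact congrArg (LinearMap.baseChange S) (ModuleCat.hom_add f g) |>.trans
      (LinearMap.baseChange_add f.hom g.hom)

/-- The complex of `S`-modules `P ⊗_R S`, formed term by term. -/
def baseChangeComplex {R : Type u} (S : Type v) [CommRing R] [CommRing S] [Algebra R S]
    (P : CochainComplex (ModuleCat.{w} R) ℤ) : CochainComplex (ModuleCat.{max w v} S) ℤ :=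
  ((ModuleCat.extendScalars (algebraMap R S)).mapHomologicalComplex (ComplexShape.up ℤ)).obj P

end Rings

section Schemes

/-- The term by term pullback `f^* E` of a complex of sheaves of modules. It is only used for flat
`f`, for which `f^*` is exact and hence `f^* E` is the derived pullback of `E`. -/
def pullbackComplex {X Y : Scheme.{u}} (f : Y ⟶ X) (E : CochainComplex X.Modules ℤ) :
    CochainComplex Y.Modules ℤ :=
  ((Scheme.Modules.pullback f).mapHomologicalComplex (ComplexShape.up ℤ)).obj E

/-- A sheaf of modules is finite free if it is isomorphic to `𝒪_X ^ n` for some `n`. -/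
def IsFiniteFree {X : Scheme.{u}} (M : X.Modules) : Prop :=
  ∃ n : ℕ, Nonempty
    (M ≅ (SheafOfModules.free (R := X.ringCatSheaf) (ULift.{u} (Fin n)) : X.Modules))

/-- A complex of `𝒪_X`-modules is perfect if, locally on `X`, it admits a quasi-isomorphism from a
bounded complex of finite free modules. -/
def IsPerfectComplex {X : Scheme.{u}} (E : CochainComplex X.Modules ℤ) : Prop :=
  ∃ 𝒰 : Scheme.Cover.{u} Scheme.zariskiPrecoverage X, ∀ i : 𝒰.I₀,
    ∃ K : CochainComplex (𝒰.X i).Modules ℤ, IsBoundedComplex K ∧ (∀ j : ℤ, IsFiniteFree (K.X j)) ∧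
      ∃ α : K ⟶ pullbackComplex (𝒰.f i) E, QuasiIso α

/-- `F` is a `τ`-form of `E` if there is a `τ`-covering of `X` on whose members the pullbacks
of `E` and `F` are quasi-isomorphic. It is used for the Zariski and the fppf topology, where the
members of a covering are flat over `X`. -/
def IsForm (τ : Precoverage Scheme.{u}) {X : Scheme.{u}} (F E : CochainComplex X.Modules ℤ) :
    Prop :=
  ∃ 𝒰 : Scheme.Cover.{u} τ X, ∀ i : 𝒰.I₀,
    QuasiIsomorphic (pullbackComplex (𝒰.f i) E) (pullbackComplex (𝒰.f i) F)

end Schemes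

end

/-! ### Replacing the coefficients of a bijective linear combination by elements of the base ring.
-/

section GenericBijectivity

open TensorProduct

/-! Local form. Let `K` be a bounded complex of finite free `R`-modules and `[K, G]` the `R`-module
of homotopy classes of morphisms. It is the cohomology in degree 0 of the Hom complex, whose terms
are finite products of Hom modules out of finite free modules; hence `[K, G] ⊗ S = [K_S, G_S]` for
`S` flat (`exists_homClass_equiv`). If `K_S` and `G_S` are isomorphic in the derived category,
K-projectivity of `K_S` yields an actual quasi-isomorphism `ψ : K_S ⟶ G_S`, whose class is a
combination `∑ s_i [f_i]` with `f_i : K ⟶ G`. Composition with `ψ` is a bijection `[K_S, K_S] →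
[K_S, G_S]`, and it is the combination with coefficients `s_i` of the base changes of the maps `[K,
K] → [K, G]` given by the `f_i`.

By `exists_bijective_sum_smul` the `s_i` can be replaced by `c_i` in `R`: over the residue field
bijectivity is the nonvanishing of a polynomial, an infinite field has a point where it does not
vanish, and Nakayama lifts the result to `R`. For `g = ∑ c_i f_i`, composition with `g_S` is then
bijective on `[K_S, -]`. Since some quasi-isomorphism `K_S ⟶ G_S` exists, this forces `g_S` to be
one (`quasiIso_of_bijective_compClass`), and faithful flatness descends this to `g`. The complex `G`
is arbitrary, which matters below, where `F` is not known to be perfect.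

Scheme form. Locally `E` is replaced by a bounded complex `K` of finite free modules. At a point `x`
below a point `y` of the covering, `𝒪_{X,x} → 𝒪_{Y,y}` is faithfully flat, so the local form gives a
quasi-isomorphism of stalks `K_x ⟶ F_x`. It consists of finitely many maps out of finite free
modules, so it extends to a morphism `g` near `x` (`IsBoundedDual.exists_pullback_hom`). To see that
`g` is a quasi-isomorphism near `x`, pull back to `Y`, where `K` and `F` both map
quasi-isomorphically to some `M`. This gives two morphisms from the pullback of `K` to `M`, one a
quasi-isomorphism and the other one at `y`; on stalks at `y` they differ by a homotopy equivalence,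
which is again finite data and extends to a neighbourhood (`IsBoundedDual.exists_forall_quasiIso`).
Its image in `X` is open, and quasi-isomorphisms descend along the faithfully flat stalk maps. -/

/-- Iterated base change of a linear combination of linear maps is bijective if and only if the
base change in one step is. -/
theorem bijective_baseChange_baseChange_iff {R B T : Type*} [CommRing R] [CommRing B] [CommRing T]
    [Algebra R B] [Algebra R T] [Algebra B T] [IsScalarTower R B T]
    {A H : Type*} [AddCommGroup A] [AddCommGroup H] [Module R A] [Module R H]
    {ι : Type*} [Fintype ι] (f : ι → A →ₗ[R] H) (t : ι → T) :
    Function.Bijective ⇑(∑ i, t i • ((f i).baseChange B).baseChange T) ↔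
      Function.Bijective ⇑(∑ i, t i • (f i).baseChange T) := by
  let eA := AlgebraTensorModule.cancelBaseChange R B T T A
  let eH := AlgebraTensorModule.cancelBaseChange R B T T H
  have h : eH.toLinearMap ∘ₗ (∑ i, t i • ((f i).baseChange B).baseChange T) =
      (∑ i, t i • (f i).baseChange T) ∘ₗ eA.toLinearMap := by
    ext a
    simp [eA, eH]
  have h' : ⇑eH ∘ ⇑(∑ i, t i • ((f i).baseChange B).baseChange T) =
      ⇑(∑ i, t i • (f i).baseChange T) ∘ ⇑eA := congrArg DFunLike.coe h
  rw [← eH.bijective.of_comp_iff', h', Function.Bijective.of_comp_iff _ eA.bijective]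

/-- After identifying `W` with `V`, the determinant of `∑ X_i f_i` is a polynomial over `k`. Its
value at `t` is the determinant of a bijection, hence a unit of `T`, so the polynomial is nonzero;
an infinite field contains a point `c` where it does not vanish. -/
theorem exists_bijective_sum_smul_of_field {k T V W ι : Type*} [Field k] [Infinite k]
    [CommRing T] [Nontrivial T] [Algebra k T] [AddCommGroup V] [Module k V] [AddCommGroup W]
    [Module k W] [Module.Finite k V] [Module.Finite k W] [Fintype ι] (f : ι → V →ₗ[k] W)
    (t : ι → T) (ht : Function.Bijective ⇑(∑ i, t i • (f i).baseChange T)) :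
    ∃ c : ι → k, Function.Bijective ⇑(∑ i, c i • f i) := by
  have hr : Module.finrank k W = Module.finrank k V := by
    rw [← Module.finrank_baseChange (R := T) (M' := V),
      ← Module.finrank_baseChange (R := T) (M' := W)]
    exact (LinearEquiv.ofBijective _ ht).finrank_eq.symm
  let e : W ≃ₗ[k] V := LinearEquiv.ofFinrankEq _ _ hr
  let b := Module.finBasis k V
  let M : ι → Matrix _ _ k := fun i ↦ LinearMap.toMatrix b b (e.toLinearMap ∘ₗ f i)
  let P : MvPolynomial ι k := (∑ i, MvPolynomial.X (R := k) i • (M i).map MvPolynomial.C).det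
  have hP : MvPolynomial.aeval t P ≠ 0 := by
    have h1 : MvPolynomial.aeval t P =
        LinearMap.det (∑ i, t i • (e.toLinearMap ∘ₗ f i).baseChange T) := by
      rw [← LinearMap.det_toMatrix (Algebra.TensorProduct.basis T b)]
      simp only [P, AlgHom.map_det, map_sum, map_smul]
      congr 1
      ext i j
      simp only [Matrix.sum_apply, AlgHom.mapMatrix_apply, Matrix.map_apply,
        Matrix.smul_apply, smul_eq_mul, map_mul, MvPolynomial.aeval_X, MvPolynomial.aeval_C]
      refine Finset.sum_congr rfl fun l _ ↦ ?_
      rw [LinearMap.toMatrix_baseChange]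
      rfl
    have h2 : (∑ i, t i • (e.toLinearMap ∘ₗ f i).baseChange T) =
        (e.baseChange k T _ _).toLinearMap ∘ₗ ∑ i, t i • (f i).baseChange T := by
      ext v
      simp [LinearMap.sum_apply]
    rw [h1, h2]
    have : IsUnit ((e.baseChange k T _ _).toLinearMap ∘ₗ ∑ i, t i • (f i).baseChange T) := by
      rw [Module.End.isUnit_iff]
      exact (e.baseChange k T _ _).bijective.comp ht
    exact (LinearMap.isUnit_det _ this).ne_zero
  have hP0 : P ≠ 0 := fun h ↦ hP (by rw [h, map_zero])
  obtain ⟨c, hc⟩ : ∃ c, MvPolynomial.eval c P ≠ 0 := by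
    by_contra! h
    exact hP0 (MvPolynomial.funext fun x ↦ by simp [h x])
  refine ⟨c, ?_⟩
  have h1 : MvPolynomial.eval c P =
      LinearMap.det (e.toLinearMap ∘ₗ ∑ i, c i • f i) := by
    rw [← LinearMap.det_toMatrix b]
    simp only [P, RingHom.map_det]
    congr 1
    have : e.toLinearMap ∘ₗ ∑ i, c i • f i = ∑ i, c i • (e.toLinearMap ∘ₗ f i) := by
      ext v
      simp [LinearMap.sum_apply]
    rw [this]
    ext i j
    simp [M, Matrix.sum_apply]
  rw [h1] at hc
  have h2 : IsUnit (e.toLinearMap ∘ₗ ∑ i, c i • f i) :=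
    LinearMap.isUnit_iff_isUnit_det _ |>.mpr hc.isUnit
  rw [Module.End.isUnit_iff] at h2
  exact (Function.Bijective.of_comp_iff' e.bijective _).mp h2

/-- Over a local ring with infinite residue field, if some linear combination of linear maps with
coefficients in a faithfully flat extension is bijective, then so is one with coefficients in the
base ring. -/
theorem exists_bijective_sum_smul {R S A H ι : Type*} [CommRing R] [IsLocalRing R]
    [Infinite (IsLocalRing.ResidueField R)] [CommRing S] [Algebra R S] [Module.FaithfullyFlat R S]
    [AddCommGroup A] [AddCommGroup H] [Module R A] [Module R H] [Module.Finite R A] [Fintype ι]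
    (f : ι → A →ₗ[R] H) (s : ι → S) (hs : Function.Bijective ⇑(∑ i, s i • (f i).baseChange S)) :
    ∃ c : ι → R, Function.Bijective ⇑(∑ i, c i • f i) := by
  let k := IsLocalRing.ResidueField R
  let T := k ⊗[R] S
  have hT : Nontrivial T := Module.FaithfullyFlat.rTensor_nontrivial R S k
  let _ : Algebra S T := Algebra.TensorProduct.rightAlgebra
  -- Finiteness of `H` is not assumed: it descends from `S ⊗ H`, a quotient of the finite module `S
  -- ⊗ A`.
  have hH : Module.Finite S (S ⊗[R] H) := Module.Finite.of_surjective _ hs.surjective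
  have : Module.Finite R H := Module.Finite.of_finite_tensorProduct_of_faithfullyFlat S
  -- The ring `T = k ⊗ S` is reached from `R` through `S`, where bijectivity is known, and through
  -- `k`, where the determinant argument applies.
  have h1 : Function.Bijective ⇑(∑ i, (algebraMap S T (s i)) • (f i).baseChange T) := by
    rw [← bijective_baseChange_baseChange_iff (B := S)]
    convert ((LinearEquiv.ofBijective _ hs).baseChange S T _ _).bijective using 1
    refine congrArg DFunLike.coe (a₁ := ∑ i, algebraMap S T (s i) • ((f i).baseChange S).baseChange T)
      (a₂ := ((LinearEquiv.ofBijective _ hs).baseChange S T _ _).toLinearMap) ?_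
    ext a
    simp [LinearMap.sum_apply, tmul_sum]
  rw [← bijective_baseChange_baseChange_iff (B := k)] at h1
  obtain ⟨c', hc'⟩ := exists_bijective_sum_smul_of_field _ _ h1
  choose c hc using fun i ↦ IsLocalRing.residue_surjective (c' i)
  refine ⟨c, ?_⟩
  set g := ∑ i, c i • f i with hg
  have hgk : Function.Surjective (g.baseChange k) := by
    convert hc'.surjective using 1
    refine congrArg DFunLike.coe (a₁ := g.baseChange k)
      (a₂ := ∑ i, c' i • (f i).baseChange k) ?_
    ext a
    simp [LinearMap.sum_apply, hg, tmul_sum, ← hc, tmul_smul]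
    rfl
  -- Nakayama for the finite module `H`: the range of `g` is everything because it is so modulo the
  -- maximal ideal.
  have hsurj : Function.Surjective g := by
    rw [← LinearMap.range_eq_top, ← IsLocalRing.map_tensorProduct_mk_eq_top, eq_top_iff]
    rintro x -
    obtain ⟨y, rfl⟩ := hgk x
    induction y with
    | zero => simp
    | add y z hy hz => rw [map_add]; exact add_mem hy hz
    | tmul r a =>
      obtain ⟨r, rfl⟩ := IsLocalRing.residue_surjective r
      refine ⟨g (r • a), ⟨_, rfl⟩, ?_⟩
      simp only [map_smul, LinearMap.baseChange_tmul, mk_apply, smul_tmul']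
      congr 1
      exact (Algebra.algebraMap_eq_smul_one (A := k) r).symm
  refine ⟨?_, hsurj⟩
  have hgS : Function.Surjective (g.baseChange S) := by
    exact LinearMap.lTensor_surjective S hsurj
  -- Composing with the inverse of the given bijection makes `g.baseChange S` a surjective
  -- endomorphism of the finite module `S ⊗ A`, which is injective.
  have hend : Function.Injective
      ((LinearEquiv.ofBijective _ hs).symm.toLinearMap ∘ₗ g.baseChange S) :=
    OrzechProperty.injective_of_surjective_endomorphism _
      ((LinearEquiv.ofBijective _ hs).symm.surjective.comp hgS)
  have hinj : Function.Injective (g.lTensor S) := Function.Injective.of_comp hend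
  exact (Module.FaithfullyFlat.lTensor_injective_iff_injective R S g).mp hinj

end GenericBijectivity

/-! ### Homology and products under flat base change. -/

noncomputable section

section HomologyBaseChange

open TensorProduct

variable {R : Type*} [CommRing R] {C₁ C₀ C₂ : Type*} [AddCommGroup C₁] [AddCommGroup C₀]
  [AddCommGroup C₂] [Module R C₁] [Module R C₀] [Module R C₂]

/-- The homology `ker b / im a` of a pair of linear maps `a` and `b`. -/
abbrev LinHomology (a : C₁ →ₗ[R] C₀) (b : C₀ →ₗ[R] C₂) : Type _ :=
  LinearMap.ker b ⧸ (LinearMap.range a).submoduleOf (LinearMap.ker b)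

variable {S : Type*} [CommRing S] [Algebra R S] [Module.Flat R S]
  {D₁ D₀ D₂ : Type*} [AddCommGroup D₁] [AddCommGroup D₀] [AddCommGroup D₂]
  [Module R D₁] [Module R D₀] [Module R D₂] [Module S D₁] [Module S D₀] [Module S D₂]
  [IsScalarTower R S D₁] [IsScalarTower R S D₀] [IsScalarTower R S D₂]
  {a : C₁ →ₗ[R] C₀} {b : C₀ →ₗ[R] C₂} {a' : D₁ →ₗ[S] D₀} {b' : D₀ →ₗ[S] D₂}
  {j₁ : C₁ →ₗ[R] D₁} {j₀ : C₀ →ₗ[R] D₀} {j₂ : C₂ →ₗ[R] D₂}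

/-- Kernels commute with flat base change. -/
theorem exists_baseChange_ker (h₀ : IsBaseChange S j₀) (h₂ : IsBaseChange S j₂)
    (hb : ∀ x, b' (j₀ x) = j₂ (b x)) (y : D₀) (hy : b' y = 0) :
    ∃ t : S ⊗[R] LinearMap.ker b, h₀.equiv ((LinearMap.ker b).subtype.baseChange S t) = y := by
  have h : ∀ t, b' (h₀.equiv t) = h₂.equiv (b.baseChange S t) := by
    intro t
    induction t with
    | zero => simp
    | add x y hx hy => simp [hx, hy]
    | tmul s x => simp [IsBaseChange.equiv_tmul, hb]
  have h' : b.lTensor S (h₀.equiv.symm y) = 0 := by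
    apply h₂.equiv.injective
    rw [map_zero]
    exact (h (h₀.equiv.symm y)).symm.trans (by simpa using hy)
  obtain ⟨t, ht⟩ := (Module.Flat.lTensor_exact S b.exact_subtype_ker_map _).mp h'
  refine ⟨t, ?_⟩
  change h₀.equiv ((LinearMap.ker b).subtype.lTensor S t) = y
  rw [ht, LinearEquiv.apply_symm_apply]

/-- Flatness makes `S ⊗ ker b` the kernel of `b'`, and right exactness handles the quotient. The
value on classes `1 ⊗ [x]` is recorded because homotopy classes of morphisms have to be followed
through the isomorphism. -/
theorem exists_linHomology_baseChange_equiv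
    (h₁ : IsBaseChange S j₁) (h₀ : IsBaseChange S j₀) (h₂ : IsBaseChange S j₂)
    (ha : ∀ x, a' (j₁ x) = j₀ (a x)) (hb : ∀ x, b' (j₀ x) = j₂ (b x)) (hab : b ∘ₗ a = 0)
    (hj : ∀ x : LinearMap.ker b, j₀ x ∈ LinearMap.ker b') :
    ∃ e : S ⊗[R] LinHomology a b ≃ₗ[S] LinHomology a' b', ∀ x : LinearMap.ker b,
      e (1 ⊗ₜ Submodule.Quotient.mk x) = Submodule.Quotient.mk ⟨j₀ x, hj x⟩ := by
  let jk : LinearMap.ker b →ₗ[R] LinearMap.ker b' :=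
    { toFun x := ⟨j₀ x, hj x⟩
      map_add' x y := by ext; simp
      map_smul' r x := by ext; simp }
  let c₀ : LinHomology a b →ₗ[R] LinHomology a' b' :=
    Submodule.liftQ _ (((Submodule.mkQ ((LinearMap.range a').submoduleOf
      (LinearMap.ker b'))).restrictScalars R) ∘ₗ jk) (by
      rintro x ⟨y, hy⟩
      rw [LinearMap.mem_ker]
      refine (Submodule.Quotient.mk_eq_zero _).mpr ⟨j₁ y, ?_⟩
      rw [ha, hy]
      rfl)
  let c : S ⊗[R] LinHomology a b →ₗ[S] LinHomology a' b' := c₀.liftBaseChange S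
  have hc : ∀ x : LinearMap.ker b,
      c (1 ⊗ₜ Submodule.Quotient.mk x) = Submodule.Quotient.mk ⟨j₀ x, hj x⟩ := by
    intro x
    simp only [c, LinearMap.liftBaseChange_tmul, one_smul]
    rfl
  have hmem (t : S ⊗[R] LinearMap.ker b) :
      h₀.equiv ((LinearMap.ker b).subtype.baseChange S t) ∈ LinearMap.ker b' := by
    induction t with
    | zero => simp
    | add x y hx hy => rw [map_add, map_add]; exact add_mem hx hy
    | tmul s x =>
      simp only [LinearMap.baseChange_tmul, IsBaseChange.equiv_tmul]
      exact Submodule.smul_mem _ _ (hj x)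
  have hct (t : S ⊗[R] LinearMap.ker b) :
      c ((Submodule.mkQ _).lTensor S t) = Submodule.Quotient.mk ⟨_, hmem t⟩ := by
    induction t with
    | zero =>
      simp only [map_zero]
      exact (Submodule.Quotient.mk_zero _).symm
    | add x y hx hy =>
      rw [map_add, map_add, hx, hy, ← Submodule.Quotient.mk_add]
      congr 1
      ext
      simp
    | tmul s x =>
      have : s ⊗ₜ[R] (Submodule.Quotient.mk x : LinHomology a b) =
        s • ((1 : S) ⊗ₜ[R] (Submodule.Quotient.mk x : LinHomology a b)) := by
          simp [smul_tmul']
      rw [LinearMap.lTensor_tmul, Submodule.mkQ_apply, this, map_smul, hc,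
        ← Submodule.Quotient.mk_smul]
      congr 1
  refine ⟨LinearEquiv.ofBijective c ⟨?_, ?_⟩, hc⟩
  -- An element killed by `c` is represented by some `t` whose image in `D₀` equals `a' y`. Since `S
  -- ⊗ ker b → S ⊗ C₀` is injective by flatness, `t` already comes from `S ⊗ C₁`.
  · rw [injective_iff_map_eq_zero]
    intro z hz
    obtain ⟨t, rfl⟩ := LinearMap.lTensor_surjective S (Submodule.mkQ_surjective _) z
    rw [hct, Submodule.Quotient.mk_eq_zero] at hz
    obtain ⟨y, hy⟩ := hz
    let a₀ : C₁ →ₗ[R] LinearMap.ker b := a.codRestrict _ (fun x ↦ LinearMap.congr_fun hab x)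
    have hinj : Function.Injective ((LinearMap.ker b).subtype.lTensor S) :=
      Module.Flat.lTensor_preserves_injective_linearMap _ (Submodule.injective_subtype _)
    have key (t₁ : S ⊗[R] C₁) : h₀.equiv ((LinearMap.ker b).subtype.baseChange S
        (a₀.baseChange S t₁)) = a' (h₁.equiv t₁) := by
      induction t₁ with
      | zero => simp
      | add x y hx hy => simp [hx, hy]
      | tmul s x =>
        simp only [LinearMap.baseChange_tmul, IsBaseChange.equiv_tmul, map_smul, ha]
        rfl
    have ht : t = a₀.lTensor S (h₁.equiv.symm y) := by
      apply hinj
      apply h₀.equiv.injective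
      refine Eq.trans ?_ (key _).symm
      rw [LinearEquiv.apply_symm_apply, hy]
      rfl
    rw [ht, ← LinearMap.comp_apply, ← LinearMap.lTensor_comp]
    have : (Submodule.mkQ ((LinearMap.range a).submoduleOf (LinearMap.ker b))) ∘ₗ a₀ = 0 := by
      ext x
      exact (Submodule.Quotient.mk_eq_zero _).mpr ⟨x, rfl⟩
    rw [this]
    simp
  · intro z
    obtain ⟨⟨y, hy⟩, rfl⟩ := Submodule.Quotient.mk_surjective _ z
    obtain ⟨t, ht⟩ := exists_baseChange_ker h₀ h₂ hb y hy
    refine ⟨(Submodule.mkQ _).lTensor S t, ?_⟩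
    rw [hct]
    congr 1
    ext
    exact ht

end HomologyBaseChange

-- Form suited to Hom complexes over `S`, whose terms carry no `R`-module structure; one is
-- installed along `algebraMap R S` inside the proof only.
open TensorProduct in
theorem exists_baseChange_linHomology_equiv {R S : Type*} [CommRing R] [CommRing S] [Algebra R S]
    [Module.Flat R S] {C₁ C₀ C₂ D₁ D₀ D₂ : Type*} [AddCommGroup C₁] [AddCommGroup C₀]
    [AddCommGroup C₂] [Module R C₁] [Module R C₀] [Module R C₂] [AddCommGroup D₁] [AddCommGroup D₀]
    [AddCommGroup D₂] [Module S D₁] [Module S D₀] [Module S D₂]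
    {a : C₁ →ₗ[R] C₀} {b : C₀ →ₗ[R] C₂} {a' : D₁ →ₗ[S] D₀} {b' : D₀ →ₗ[S] D₂}
    (e₁ : S ⊗[R] C₁ ≃ₗ[S] D₁) (e₀ : S ⊗[R] C₀ ≃ₗ[S] D₀) (e₂ : S ⊗[R] C₂ ≃ₗ[S] D₂)
    (ha : ∀ x, a' (e₁ (1 ⊗ₜ x)) = e₀ (1 ⊗ₜ a x)) (hb : ∀ x, b' (e₀ (1 ⊗ₜ x)) = e₂ (1 ⊗ₜ b x))
    (hab : b ∘ₗ a = 0) (hj : ∀ x : LinearMap.ker b, e₀ (1 ⊗ₜ x.1) ∈ LinearMap.ker b') :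
    ∃ e : S ⊗[R] LinHomology a b ≃ₗ[S] LinHomology a' b', ∀ x : LinearMap.ker b,
      e (1 ⊗ₜ Submodule.Quotient.mk x) = Submodule.Quotient.mk ⟨e₀ (1 ⊗ₜ x.1), hj x⟩ := by
  let _ : Module R D₁ := Module.compHom D₁ (algebraMap R S)
  let _ : Module R D₀ := Module.compHom D₀ (algebraMap R S)
  let _ : Module R D₂ := Module.compHom D₂ (algebraMap R S)
  have : IsScalarTower R S D₁ := .of_algebraMap_smul fun _ _ ↦ rfl
  have : IsScalarTower R S D₀ := .of_algebraMap_smul fun _ _ ↦ rfl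
  have : IsScalarTower R S D₂ := .of_algebraMap_smul fun _ _ ↦ rfl
  exact exists_linHomology_baseChange_equiv
    (j₁ := e₁.toLinearMap.restrictScalars R ∘ₗ TensorProduct.mk R S C₁ 1)
    (j₀ := e₀.toLinearMap.restrictScalars R ∘ₗ TensorProduct.mk R S C₀ 1)
    (j₂ := e₂.toLinearMap.restrictScalars R ∘ₗ TensorProduct.mk R S C₂ 1)
    (.of_equiv e₁ fun _ ↦ rfl) (.of_equiv e₀ fun _ ↦ rfl) (.of_equiv e₂ fun _ ↦ rfl) ha hb hab hj

open TensorProduct in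
/-- Base change commutes with products with finitely many nonzero factors. -/
theorem exists_baseChange_pi_equiv {R S : Type*} [CommRing R] [CommRing S] [Algebra R S]
    {ι : Type*} (I : Set ι) (hI : I.Finite) {M M' : ι → Type*} [∀ i, AddCommGroup (M i)]
    [∀ i, AddCommGroup (M' i)] [∀ i, Module R (M i)] [∀ i, Module S (M' i)]
    (j : ∀ i, M i → M' i)
    (hj : ∀ i ∈ I, ∃ e : S ⊗[R] M i ≃ₗ[S] M' i, ∀ x, e (1 ⊗ₜ x) = j i x)
    (hM : ∀ i ∉ I, Subsingleton (M i)) (hM' : ∀ i ∉ I, Subsingleton (M' i)) :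
    ∃ e : S ⊗[R] (∀ i, M i) ≃ₗ[S] (∀ i, M' i), ∀ x, e (1 ⊗ₜ x) = fun i ↦ j i (x i) := by
  classical
  have := hI.to_subtype
  have := Fintype.ofFinite I
  choose e he using fun i : I ↦ hj i i.2
  let p : (∀ i, M i) ≃ₗ[R] (∀ i : I, M i) :=
    LinearEquiv.ofBijective (.pi fun i : I ↦ .proj (i : ι))
      ⟨fun x y h ↦ funext fun i ↦ if hi : i ∈ I then congrFun h ⟨i, hi⟩ else
        (hM i hi).elim _ _, fun x ↦ ⟨fun i ↦ if hi : i ∈ I then x ⟨i, hi⟩ else 0,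
        funext fun i ↦ by simp⟩⟩
  let p' : (∀ i, M' i) ≃ₗ[S] (∀ i : I, M' i) :=
    LinearEquiv.ofBijective (.pi fun i : I ↦ .proj (i : ι))
      ⟨fun x y h ↦ funext fun i ↦ if hi : i ∈ I then congrFun h ⟨i, hi⟩ else
        (hM' i hi).elim _ _, fun x ↦ ⟨fun i ↦ if hi : i ∈ I then x ⟨i, hi⟩ else 0,
        funext fun i ↦ by simp⟩⟩
  refine ⟨p.baseChange R S _ _ ≪≫ₗ TensorProduct.piRight R S S _ ≪≫ₗ .piCongrRight e ≪≫ₗ p'.symm,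
    fun x ↦ p'.injective ?_⟩
  ext i
  simp only [LinearEquiv.trans_apply, LinearEquiv.baseChange_tmul, LinearEquiv.apply_symm_apply,
    piRight_apply, piRightHom_tmul, LinearEquiv.piCongrRight_apply, he]
  rfl

/-- Meant for modules of cochains: products over infinitely many triplets of which only finitely
many factors survive when the source is bounded. -/
theorem Module.Finite.pi_of_subsingleton {R : Type*} [CommRing R] [IsNoetherianRing R]
    {ι : Type*} (I : Set ι) (hI : I.Finite) {M : ι → Type*} [∀ i, AddCommGroup (M i)]
    [∀ i, Module R (M i)] (h : ∀ i ∈ I, Module.Finite R (M i))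
    (hM : ∀ i ∉ I, Subsingleton (M i)) : Module.Finite R (∀ i, M i) := by
  classical
  have := hI.to_subtype
  have (i : I) : Module.Finite R (M i) := h i i.2
  exact Module.Finite.of_injective (.pi fun i : I ↦ .proj (i : ι) : _ →ₗ[R] (∀ i : I, M i))
    fun x y h ↦ funext fun i ↦ if hi : i ∈ I then congrFun h ⟨i, hi⟩ else (hM i hi).elim _ _

end

/-! ### Homotopy classes of morphisms as a module. -/

noncomputable section

section HomClasses

open CochainComplex HomComplex

/-- The module of `0`-cocycles of the Hom complex. -/
abbrev HomCocycle (R : Type*) [CommRing R] {C : Type*} [Category C] [Preadditive C] [Linear R C]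
    (K L : CochainComplex C ℤ) : Submodule R (Cochain K L 0) :=
  LinearMap.ker (δ_hom R K L 0 1)

/-- The module of homotopy classes of morphisms of complexes. -/
abbrev HomClass (R : Type*) [CommRing R] {C : Type*} [Category C] [Preadditive C] [Linear R C]
    (K L : CochainComplex C ℤ) : Type _ :=
  LinHomology (δ_hom R K L (-1) 0) (δ_hom R K L 0 1)

variable (R : Type*) [CommRing R] {C : Type*} [Category C] [Preadditive C] [Linear R C]
  {F G K : CochainComplex C ℤ}

/-- The cocycle of a morphism of complexes. -/
def homCocycle (f : F ⟶ G) : HomCocycle R F G := ⟨Cochain.ofHom f, by simp⟩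

theorem exists_homCocycle_eq (z : HomCocycle R F G) : ∃ f : F ⟶ G, homCocycle R f = z := by
  refine ⟨Cocycle.homOf (Cocycle.mk z.1 1 (zero_add 1) z.2), ?_⟩
  ext : 1
  exact Cocycle.cochain_ofHom_homOf_eq_coe _

/-- The homotopy class of a morphism of complexes. -/
def homClass (f : F ⟶ G) : HomClass R F G := Submodule.Quotient.mk (homCocycle R f)

theorem exists_homClass_eq (z : HomClass R F G) : ∃ f : F ⟶ G, homClass R f = z := by
  obtain ⟨z, rfl⟩ := Submodule.Quotient.mk_surjective _ z
  obtain ⟨f, rfl⟩ := exists_homCocycle_eq R z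
  exact ⟨f, rfl⟩

theorem homClass_eq_iff (f g : F ⟶ G) : homClass R f = homClass R g ↔ Nonempty (Homotopy f g) := by
  rw [homClass, homClass, Submodule.Quotient.eq, (Cochain.equivHomotopy f g).nonempty_congr]
  constructor
  · rintro ⟨z, hz⟩
    exact ⟨⟨z, eq_add_of_sub_eq hz.symm⟩⟩
  · rintro ⟨z, hz⟩
    exact ⟨z, (sub_eq_of_eq_add hz).symm⟩

/-- Composition of homotopy classes with a cocycle. -/
def compClass (F : CochainComplex C ℤ) :
    HomCocycle R G K →ₗ[R] HomClass R F G →ₗ[R] HomClass R F K where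
  toFun β := Submodule.mapQ _ _
    { toFun α := ⟨α.1.comp β.1 (zero_add 0), by
        have hα : δ 0 1 α.1 = 0 := α.2
        have hβ : δ 0 1 β.1 = 0 := β.2
        rw [LinearMap.mem_ker, δ_hom_apply, δ_comp_zero_cochain _ _ _ (zero_add 1), hα, hβ]
        simp⟩
      map_add' x y := by ext : 1; exact Cochain.add_comp _ _ _ (zero_add 0)
      map_smul' r x := by ext : 1; exact Cochain.smul_comp _ _ _ (zero_add 0) } (by
    rintro α ⟨y, hy⟩
    refine ⟨y.comp β.1 (add_zero _), ?_⟩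
    have hβ : δ 0 1 β.1 = 0 := β.2
    change δ (-1) 0 y = α.1 at hy
    change δ (-1) 0 (y.comp β.1 (add_zero _)) = α.1.comp β.1 (zero_add 0)
    rw [δ_comp_zero_cochain _ _ _ (neg_add_cancel 1), hβ, hy]
    simp)
  -- Linearity in the cocycle turns composition with a combination of morphisms into the same
  -- combination of composition maps.
  map_add' x y := by
    ext z : 2
    refine congrArg Submodule.Quotient.mk (Subtype.ext ?_)
    exact Cochain.comp_add _ _ _ (zero_add 0)
  map_smul' r x := by
    ext z : 2
    refine congrArg Submodule.Quotient.mk (Subtype.ext ?_)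
    exact Cochain.comp_smul _ _ _ (zero_add 0)

theorem compClass_homCocycle (f : F ⟶ G) (g : G ⟶ K) :
    compClass R F (homCocycle R g) (homClass R f) = homClass R (f ≫ g) :=
  congrArg Submodule.Quotient.mk (Subtype.ext (Cochain.ofHom_comp f g).symm)

end HomClasses

/-! ### Morphisms out of K-projective complexes. -/

section KProjective

open CochainComplex

variable {C : Type u} [Category.{v} C] [Abelian C] {K L M : CochainComplex C ℤ}

-- Out of a K-projective complex, morphisms in the homotopy category and in the derived category
-- agree, and `φ` becomes invertible in the latter.
attribute [local instance] HasDerivedCategory.standard in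
theorem bijective_comp_quotient_map (K : CochainComplex C ℤ) [K.IsKProjective] (φ : L ⟶ M)
    [QuasiIso φ] : Function.Bijective fun a : (HomotopyCategory.quotient _ _).obj K ⟶
      (HomotopyCategory.quotient _ _).obj L ↦ a ≫ (HomotopyCategory.quotient _ _).map φ := by
  have hL := IsKProjective.Qh_map_bijective K ((HomotopyCategory.quotient _ _).obj L)
  have hM := IsKProjective.Qh_map_bijective K ((HomotopyCategory.quotient _ _).obj M)
  have : IsIso (DerivedCategory.Qh.map ((HomotopyCategory.quotient C (.up ℤ)).map φ)) := by
    have := (NatIso.isIso_map_iff (DerivedCategory.quotientCompQhIso C) φ).mpr inferInstance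
    exact this
  rw [← hM.of_comp_iff']
  have h : DerivedCategory.Qh.map ∘ (fun a : (HomotopyCategory.quotient _ _).obj K ⟶
      (HomotopyCategory.quotient _ _).obj L ↦ a ≫ (HomotopyCategory.quotient _ _).map φ) =
      (fun b ↦ b ≫ DerivedCategory.Qh.map ((HomotopyCategory.quotient C (.up ℤ)).map φ)) ∘
        DerivedCategory.Qh.map := by
    ext a
    simp
  rw [h]
  exact Function.Bijective.comp
    ((asIso (DerivedCategory.Qh.map ((HomotopyCategory.quotient C (.up ℤ)).map φ))).homToEquiv.bijective) hL

theorem CochainComplex.IsKProjective.exists_lift [K.IsKProjective] (φ : L ⟶ M) [QuasiIso φ]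
    (h : K ⟶ M) : ∃ a : K ⟶ L, Nonempty (Homotopy (a ≫ φ) h) := by
  obtain ⟨a, ha⟩ := (bijective_comp_quotient_map K φ).surjective
    ((HomotopyCategory.quotient _ _).map h)
  obtain ⟨a, rfl⟩ := (HomotopyCategory.quotient _ _).map_surjective a
  exact ⟨a, ⟨HomotopyCategory.homotopyOfEq _ _ (by simpa using ha)⟩⟩

theorem CochainComplex.IsKProjective.homotopy_of_comp [K.IsKProjective] (φ : L ⟶ M) [QuasiIso φ]
    {a b : K ⟶ L} (h : Homotopy (a ≫ φ) (b ≫ φ)) : Nonempty (Homotopy a b) := by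
  refine ⟨HomotopyCategory.homotopyOfEq _ _ ((bijective_comp_quotient_map K φ).injective ?_)⟩
  simpa using HomotopyCategory.eq_of_homotopy _ _ h

theorem bijective_compClass (R : Type*) [CommRing R] [Linear R C] [K.IsKProjective] (φ : L ⟶ M)
    [QuasiIso φ] : Function.Bijective (compClass R K (homCocycle R φ)) := by
  constructor
  · intro x y h
    obtain ⟨a, rfl⟩ := exists_homClass_eq R x
    obtain ⟨b, rfl⟩ := exists_homClass_eq R y
    rw [compClass_homCocycle, compClass_homCocycle, homClass_eq_iff] at h
    exact (homClass_eq_iff R a b).mpr (IsKProjective.homotopy_of_comp φ h.some)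
  · intro y
    obtain ⟨b, rfl⟩ := exists_homClass_eq R y
    obtain ⟨a, ha⟩ := IsKProjective.exists_lift φ b
    exact ⟨homClass R a, by rwa [compClass_homCocycle, homClass_eq_iff]⟩

theorem QuasiIso.of_homotopy {f g : K ⟶ L} (h : Homotopy f g) [QuasiIso g] : QuasiIso f := by
  rw [quasiIso_iff]
  intro i
  rw [quasiIsoAt_iff_isIso_homologyMap, h.homologyMap_eq, ← quasiIsoAt_iff_isIso_homologyMap]
  infer_instance

/-- If postcomposition with `g` is bijective on homotopy classes of morphisms from `K` and there is
some quasi-isomorphism from the K-projective complex `K` to `L`, then `g` is one. -/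
theorem quasiIso_of_bijective_compClass (R : Type*) [CommRing R] [Linear R C] [K.IsKProjective]
    (φ g : K ⟶ L) [QuasiIso φ] (hg : Function.Bijective (compClass R K (homCocycle R g))) :
    QuasiIso g := by
  -- Up to homotopy, `b ≫ g` is `φ` and `a ≫ φ` is `g`. Cancelling `g` gives `a ≫ b ∼ 𝟙`, cancelling
  -- `φ` gives `b ≫ a ∼ 𝟙`; so `a` is a homotopy equivalence and `g ∼ a ≫ φ`.
  obtain ⟨b, hb⟩ := hg.surjective (homClass R φ)
  obtain ⟨b, rfl⟩ := exists_homClass_eq R b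
  obtain ⟨a, ⟨ha⟩⟩ := IsKProjective.exists_lift φ g
  rw [compClass_homCocycle, homClass_eq_iff] at hb
  obtain ⟨hb⟩ := hb
  have hab : Nonempty (Homotopy (a ≫ b) (𝟙 K)) := by
    rw [← homClass_eq_iff R]
    apply hg.injective
    rw [compClass_homCocycle, compClass_homCocycle, homClass_eq_iff, Category.assoc,
      Category.id_comp]
    exact ⟨(hb.compLeft a).trans ha⟩
  have hba : Nonempty (Homotopy (b ≫ a) (𝟙 K)) := by
    refine IsKProjective.homotopy_of_comp φ ?_
    rw [Category.assoc, Category.id_comp]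
    exact (ha.compLeft b).trans hb
  let e : HomotopyEquiv K K := ⟨a, b, hab.some, hba.some⟩
  have : QuasiIso a := e.quasiIso_hom
  exact .of_homotopy ha.symm

end KProjective

end

/-! ### Extension of scalars of complexes and of their Hom complexes. -/

noncomputable section

section ExtendScalars

open TensorProduct CochainComplex HomComplex

variable {R : Type u} {S : Type v} [CommRing R] [CommRing S] (φ : R →+* S)

/-- The `S`-linear identification of the extension of scalars with the tensor product. -/
def extendScalarsEquiv (M : ModuleCat.{w} R) :
    letI := φ.toAlgebra
    (ModuleCat.extendScalars.{u, v, w} φ).obj M ≃ₗ[S] S ⊗[R] M :=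
  letI := φ.toAlgebra
  LinearEquiv.refl _ _

theorem preservesHomology_extendScalars (hφ : φ.Flat) :
    (ModuleCat.extendScalars.{u, v, w} φ).PreservesHomology := by
  let _ := φ.toAlgebra
  have : Module.Flat R S := hφ
  refine Functor.preservesHomology_of_map_exact _ fun K hK ↦ ?_
  rw [ShortComplex.ShortExact.moduleCat_exact_iff_function_exact] at hK ⊢
  exact Module.Flat.lTensor_exact S hK

theorem reflectsIsomorphisms_extendScalars (hφ : φ.FaithfullyFlat) :
    (ModuleCat.extendScalars.{u, v, w} φ).ReflectsIsomorphisms := by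
  refine ⟨fun {M N} g h ↦ ?_⟩
  let _ := φ.toAlgebra
  have : Module.FaithfullyFlat R S := hφ
  rw [ConcreteCategory.isIso_iff_bijective] at h ⊢
  exact (Module.FaithfullyFlat.lTensor_bijective_iff_bijective R S g.hom).mp h

theorem quasiIso_extendScalars_map_iff (hφ : φ.FaithfullyFlat)
    {K L : CochainComplex (ModuleCat.{w} R) ℤ} (f : K ⟶ L) :
    QuasiIso (((ModuleCat.extendScalars.{u, v, w} φ).mapHomologicalComplex _).map f) ↔
      QuasiIso f := by
  have := preservesHomology_extendScalars.{u, v, w} φ hφ.flat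
  have := reflectsIsomorphisms_extendScalars.{u, v, w} φ hφ
  exact HomologicalComplex.quasiIso_map_iff_of_preservesHomology f
    (ModuleCat.extendScalars.{u, v, w} φ)

theorem exists_baseChange_linearMap_equiv {R S : Type*} [CommRing R] [CommRing S] [Algebra R S]
    (M N : Type*) [AddCommGroup M] [AddCommGroup N] [Module R M] [Module R N] [Module.Free R M]
    [Module.Finite R M] :
    ∃ e : S ⊗[R] (M →ₗ[R] N) ≃ₗ[S] (S ⊗[R] M →ₗ[S] S ⊗[R] N),
      ∀ f, e (1 ⊗ₜ f) = f.baseChange S := by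
  have h := IsBaseChange.linearMapLeftRight (TensorProduct.isBaseChange R M S)
    (TensorProduct.isBaseChange R N S)
  refine ⟨h.equiv, fun f ↦ ?_⟩
  have hf : IsBaseChange.linearMapLeftRightHom (TensorProduct.isBaseChange R M S)
      (TensorProduct.mk R S N 1) f = f.baseChange S := by
    ext m
    simpa using IsBaseChange.linearMapLeftRightHom_comp_apply
      (TensorProduct.isBaseChange R M S) (TensorProduct.mk R S N 1) f m
  rw [IsBaseChange.equiv_tmul, one_smul, hf]

theorem exists_extendScalars_hom_equiv (M N : ModuleCat.{w} R) [Module.Free R M]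
    [Module.Finite R M] :
    letI := φ.toAlgebra
    ∃ e : S ⊗[R] (M ⟶ N) ≃ₗ[S]
      ((ModuleCat.extendScalars.{u, v, w} φ).obj M ⟶ (ModuleCat.extendScalars φ).obj N),
      ∀ f, e (1 ⊗ₜ f) = (ModuleCat.extendScalars φ).map f := by
  let _ := φ.toAlgebra
  obtain ⟨e, he⟩ := exists_baseChange_linearMap_equiv (R := R) (S := S) M N
  let e₁ : S ⊗[R] (M ⟶ N) ≃ₗ[S] S ⊗[R] (M →ₗ[R] N) :=
    (ModuleCat.homLinearEquiv (S := R)).baseChange R S _ _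
  let e₂ := ModuleCat.homLinearEquiv (S := S)
    (M := (ModuleCat.extendScalars.{u, v, w} φ).obj M) (N := (ModuleCat.extendScalars φ).obj N)
  let e₃ : ((ModuleCat.extendScalars.{u, v, w} φ).obj M →ₗ[S]
      (ModuleCat.extendScalars.{u, v, w} φ).obj N) ≃ₗ[S] (S ⊗[R] M →ₗ[S] S ⊗[R] N) :=
    (extendScalarsEquiv.{u, v, w} φ M).arrowCongr (extendScalarsEquiv.{u, v, w} φ N)
  refine ⟨e₁ ≪≫ₗ e ≪≫ₗ e₃.symm ≪≫ₗ e₂.symm, fun f ↦ ?_⟩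
  apply e₂.injective
  apply e₃.injective
  simp only [LinearEquiv.trans_apply, LinearEquiv.apply_symm_apply, e₁,
    LinearEquiv.baseChange_tmul, he]
  rfl

/-- The set of triplets on which a cochain on a bounded complex may be nonzero. -/
theorem finite_triplet (n a b : ℤ) : {t : Triplet n | a ≤ t.p ∧ t.p ≤ b}.Finite := by
  refine Set.Finite.of_finite_image (f := Triplet.p)
    ((Set.finite_Icc a b).subset (by rintro _ ⟨t, ht, rfl⟩; exact ht)) ?_
  rintro ⟨p, q, h⟩ - ⟨p', q', h'⟩ - (rfl : p = p')
  obtain rfl : q = q' := by lia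
  rfl

theorem isZero_of_isStrictly {C : Type*} [Category C] [Limits.HasZeroMorphisms C]
    (K : CochainComplex C ℤ) (a b : ℤ) [K.IsStrictlyGE a] [K.IsStrictlyLE b] (p : ℤ)
    (hp : ¬ (a ≤ p ∧ p ≤ b)) : Limits.IsZero (K.X p) := by
  by_cases h : a ≤ p
  · exact K.isZero_of_isStrictlyLE b p (by lia)
  · exact K.isZero_of_isStrictlyGE a p (by lia)

variable (K G : CochainComplex (ModuleCat.{w} R) ℤ)

/-- Boundedness of `K` leaves finitely many nonzero Hom factors, and each commutes with base change
because its source is finite free. Nothing is needed of `G`. -/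
theorem exists_cochain_equiv (hK : IsBoundedComplex K)
    (hf : ∀ i, Module.Finite R (K.X i) ∧ Module.Free R (K.X i)) (n : ℤ) :
    letI := φ.toAlgebra
    ∃ e : S ⊗[R] Cochain K G n ≃ₗ[S]
      Cochain (((ModuleCat.extendScalars.{u, v, w} φ).mapHomologicalComplex _).obj K)
        (((ModuleCat.extendScalars.{u, v, w} φ).mapHomologicalComplex _).obj G) n,
      ∀ z, e (1 ⊗ₜ z) = z.map _ := by
  obtain ⟨a, b, _, _⟩ := hK
  let _ := φ.toAlgebra
  refine exists_baseChange_pi_equiv _ (finite_triplet n a b)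
    (M := fun t : Triplet n ↦ (K.X t.p ⟶ G.X t.q))
    (fun t f ↦ (ModuleCat.extendScalars φ).map f) ?_ ?_ ?_
  · intro t _
    have := (hf t.p).1
    have := (hf t.p).2
    exact exists_extendScalars_hom_equiv φ _ _
  · intro t ht
    exact ⟨fun x y ↦ (isZero_of_isStrictly K a b t.p ht).eq_of_src _ _⟩
  · intro t ht
    exact ⟨fun x y ↦ (Functor.map_isZero _ (isZero_of_isStrictly K a b t.p ht)).eq_of_src _ _⟩

/-- Homotopy classes of morphisms from a bounded complex of finite free modules commute with flat
base change. -/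
theorem exists_homClass_equiv (hφ : φ.Flat) (hK : IsBoundedComplex K)
    (hf : ∀ i, Module.Finite R (K.X i) ∧ Module.Free R (K.X i)) :
    letI := φ.toAlgebra
    ∃ e : S ⊗[R] HomClass R K G ≃ₗ[S]
      HomClass S (((ModuleCat.extendScalars.{u, v, w} φ).mapHomologicalComplex _).obj K)
        (((ModuleCat.extendScalars.{u, v, w} φ).mapHomologicalComplex _).obj G),
      ∀ f : K ⟶ G, e (1 ⊗ₜ homClass R f) =
        homClass S (((ModuleCat.extendScalars.{u, v, w} φ).mapHomologicalComplex _).map f) := by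
  let _ := φ.toAlgebra
  have : Module.Flat R S := hφ
  obtain ⟨e₁, h₁⟩ := exists_cochain_equiv φ K G hK hf (-1)
  obtain ⟨e₀, h₀⟩ := exists_cochain_equiv φ K G hK hf 0
  obtain ⟨e₂, h₂⟩ := exists_cochain_equiv φ K G hK hf 1
  -- Only degrees -1, 0 and 1 of the Hom complex enter; functors commute with `δ` by `δ_map`.
  obtain ⟨e, he⟩ := exists_baseChange_linHomology_equiv (a := δ_hom R K G (-1) 0)
    (b := δ_hom R K G 0 1) (a' := δ_hom S _ _ (-1) 0) (b' := δ_hom S _ _ 0 1) e₁ e₀ e₂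
    (fun x ↦ by rw [h₁, h₀, δ_hom_apply, δ_hom_apply, δ_map])
    (fun x ↦ by rw [h₀, h₂, δ_hom_apply, δ_hom_apply, δ_map])
    (by ext x : 1; exact δ_δ _ _ _ x)
    (fun x ↦ by
      rw [LinearMap.mem_ker, h₀, δ_hom_apply, δ_map, show δ 0 1 x.1 = 0 from x.2]
      exact Cochain.map_zero ..)
  refine ⟨e, fun f ↦ (he _).trans (congrArg Submodule.Quotient.mk (Subtype.ext ?_))⟩
  exact (h₀ _).trans (Cochain.map_ofHom ..)

end ExtendScalars

end

/-! ### The local form. -/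

noncomputable section

section LocalForm

open TensorProduct CochainComplex HomComplex

attribute [local instance] HasDerivedCategory.standard in
theorem QuasiIsomorphic.of_quasiIso {C : Type u} [Category.{v} C] [Abelian C]
    {K L : CochainComplex C ℤ} (f : K ⟶ L) [QuasiIso f] : QuasiIsomorphic K L :=
  ⟨asIso (DerivedCategory.Q.map f)⟩

theorem QuasiIsomorphic.symm {C : Type u} [Category.{v} C] [Abelian C]
    {K L : CochainComplex C ℤ} (h : QuasiIsomorphic K L) : QuasiIsomorphic L K :=
  ⟨h.some.symm⟩

theorem QuasiIsomorphic.trans {C : Type u} [Category.{v} C] [Abelian C]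
    {K L M : CochainComplex C ℤ} (h : QuasiIsomorphic K L) (h' : QuasiIsomorphic L M) :
    QuasiIsomorphic K M :=
  ⟨h.some ≪≫ h'.some⟩

-- `Qh` is bijective on morphisms out of a K-projective complex, so the isomorphism in the derived
-- category comes from a morphism of complexes.
attribute [local instance] HasDerivedCategory.standard in
theorem QuasiIsomorphic.exists_quasiIso {C : Type u} [Category.{v} C] [Abelian C]
    {K L : CochainComplex C ℤ} [K.IsKProjective] (h : QuasiIsomorphic K L) :
    ∃ f : K ⟶ L, QuasiIso f := by
  obtain ⟨e⟩ := h
  obtain ⟨f, hf⟩ := (IsKProjective.Qh_map_bijective K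
    ((HomotopyCategory.quotient _ _).obj L)).surjective
    ((DerivedCategory.quotientCompQhIso C).hom.app K ≫ e.hom ≫
      (DerivedCategory.quotientCompQhIso C).inv.app L)
  obtain ⟨f, rfl⟩ := (HomotopyCategory.quotient _ _).map_surjective f
  refine ⟨f, ?_⟩
  rw [← DerivedCategory.isIso_Q_map_iff_quasiIso,
    ← NatIso.isIso_map_iff (DerivedCategory.quotientCompQhIso C)]
  change IsIso (DerivedCategory.Qh.map ((HomotopyCategory.quotient C (.up ℤ)).map f))
  rw [hf]
  infer_instance

theorem IsStrictlyPerfect.isKProjective {R : Type u} [CommRing R] [Small.{w} R]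
    {K : CochainComplex (ModuleCat.{w} R) ℤ} (hK : IsStrictlyPerfect K) : K.IsKProjective := by
  obtain ⟨⟨a, b, _, _⟩, hK⟩ := hK
  have (i : ℤ) : Projective (K.X i) := by
    have := (hK i).2
    exact (IsProjective.iff_projective.{w} (R := R) (K.X i)).mp inferInstance
  exact isKProjective_of_projective K b

/-- If homotopy classes of morphisms from `K` commute with a faithfully flat base change along an
additive functor `T`, and some morphism from `T(K)` to `T(G)` is a quasi-isomorphism, then so is the
image of a morphism from `K` to `G`. -/
theorem exists_quasiIso_map_of_homClass_equiv {R S : Type*} [CommRing R] [CommRing S] [Algebra R S]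
    [Module.FaithfullyFlat R S] [IsLocalRing R] [Infinite (IsLocalRing.ResidueField R)]
    {C : Type*} [Category C] [Preadditive C] [Linear R C] {D : Type u} [Category.{v} D] [Abelian D]
    [Linear S D] (T : C ⥤ D) [T.Additive] {K G : CochainComplex C ℤ} [Module.Finite R (HomClass R K K)]
    (eK : S ⊗[R] HomClass R K K ≃ₗ[S]
      HomClass S ((T.mapHomologicalComplex _).obj K) ((T.mapHomologicalComplex _).obj K))
    (heK : ∀ f : K ⟶ K, eK (1 ⊗ₜ homClass R f) = homClass S ((T.mapHomologicalComplex _).map f))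
    (eG : S ⊗[R] HomClass R K G ≃ₗ[S]
      HomClass S ((T.mapHomologicalComplex _).obj K) ((T.mapHomologicalComplex _).obj G))
    (heG : ∀ f : K ⟶ G, eG (1 ⊗ₜ homClass R f) = homClass S ((T.mapHomologicalComplex _).map f))
    [CochainComplex.IsKProjective ((T.mapHomologicalComplex (.up ℤ)).obj K)]
    (ψ : (T.mapHomologicalComplex (.up ℤ)).obj K ⟶ (T.mapHomologicalComplex (.up ℤ)).obj G)
    [QuasiIso ψ] : ∃ g : K ⟶ G, QuasiIso ((T.mapHomologicalComplex (.up ℤ)).map g) := by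
  -- Under `eK` and `eG`, the base change of composition with `f` is composition with the image of
  -- `f`.
  have hcomm (f : K ⟶ G) (x : S ⊗[R] HomClass R K K) :
      eG ((compClass R K (homCocycle R f)).baseChange S x) =
        compClass S ((T.mapHomologicalComplex _).obj K) (homCocycle S ((T.mapHomologicalComplex _).map f)) (eK x) := by
    induction x with
    | zero => simp
    | add x y hx hy => simp only [map_add, hx, hy]
    | tmul s x =>
      obtain ⟨a, rfl⟩ := exists_homClass_eq R x
      have h1 : s ⊗ₜ[R] homClass R a = s • ((1 : S) ⊗ₜ[R] homClass R a) := by simp [smul_tmul']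
      rw [h1, map_smul, map_smul, map_smul, map_smul, heK, LinearMap.baseChange_tmul,
        compClass_homCocycle, compClass_homCocycle, heG, Functor.map_comp]
  have hsum : ∃ (n : ℕ) (s : Fin n → S) (f : Fin n → (K ⟶ G)),
      homClass S ψ = ∑ i, s i • homClass S ((T.mapHomologicalComplex _).map (f i)) := by
    obtain ⟨z, hz⟩ := eG.surjective (homClass S ψ)
    obtain ⟨n, s, y, rfl⟩ := TensorProduct.exists_sum_tmul_eq z
    choose f hf using fun i ↦ exists_homClass_eq R (y i)
    refine ⟨n, s, f, ?_⟩
    rw [← hz, map_sum]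
    refine Finset.sum_congr rfl fun i _ ↦ ?_
    have h1 : s i ⊗ₜ[R] y i = s i • ((1 : S) ⊗ₜ[R] homClass R (f i)) := by simp [smul_tmul', hf]
    rw [h1, map_smul, heG]
  obtain ⟨n, s, f, hs⟩ := hsum
  -- `ψ` is only homotopic to a combination of images of the `f i`; `ψ'` is that combination on the
  -- nose, so `compClass` can be expanded linearly.
  obtain ⟨ψ', hψ'⟩ := exists_homCocycle_eq S (∑ i, s i • homCocycle S ((T.mapHomologicalComplex _).map (f i)))
  have hψψ' : homClass S ψ' = homClass S ψ := by
    rw [hs, homClass, hψ']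
    exact map_sum (Submodule.mkQ _) _ _ |>.trans (Finset.sum_congr rfl fun i _ ↦ map_smul _ _ _)
  have : QuasiIso ψ' := .of_homotopy ((homClass_eq_iff S _ _).mp hψψ').some
  have hbij := bijective_compClass (K := (T.mapHomologicalComplex _).obj K) S ψ'
  have key : Function.Bijective
      ⇑(∑ i, s i • (compClass R K (homCocycle R (f i))).baseChange S) := by
    rw [← eG.bijective.of_comp_iff']
    have h1 : ⇑eG ∘ ⇑(∑ i, s i • (compClass R K (homCocycle R (f i))).baseChange S) =
        compClass S ((T.mapHomologicalComplex _).obj K) (homCocycle S ψ') ∘ eK := by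
      ext x
      simp [hψ', hcomm]
    rw [h1]
    exact hbij.comp eK.bijective
  obtain ⟨c, hc⟩ := exists_bijective_sum_smul _ s key
  obtain ⟨g, hg⟩ := exists_homCocycle_eq R (∑ i, c i • homCocycle R (f i))
  refine ⟨g, ?_⟩
  have hgb : Function.Bijective (compClass R K (homCocycle R g)) := by
    rw [hg, map_sum]
    simpa only [map_smul] using hc
  -- Bijectivity over `R` does not yet make `g` a quasi-isomorphism, for no quasi-isomorphism from
  -- `K` to `G` is available there. After base change `ψ` is one, and the criterion applies.
  have hgS : Function.Bijective (compClass S ((T.mapHomologicalComplex _).obj K) (homCocycle S ((T.mapHomologicalComplex _).map g))) := by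
    rw [← Function.Bijective.of_comp_iff _ eK.bijective]
    have h1 : ⇑(compClass S ((T.mapHomologicalComplex _).obj K) (homCocycle S ((T.mapHomologicalComplex _).map g))) ∘ ⇑eK =
        eG ∘ ((LinearEquiv.ofBijective _ hgb).baseChange R S _ _) := by
      ext x
      exact (hcomm g x).symm
    rw [h1]
    exact eG.bijective.comp (LinearEquiv.bijective _)
  exact quasiIso_of_bijective_compClass S ψ ((T.mapHomologicalComplex _).map g) hgS

variable {R : Type u} {S : Type v} [CommRing R] [CommRing S] (φ : R →+* S)

theorem IsBoundedComplex.map {C D : Type*} [Category C] [Category D] [Abelian C] [Abelian D]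
    (F : C ⥤ D) [F.Additive] {K : CochainComplex C ℤ} (hK : IsBoundedComplex K) :
    IsBoundedComplex ((F.mapHomologicalComplex _).obj K) := by
  obtain ⟨a, b, _, _⟩ := hK
  refine ⟨a, b, ?_, ?_⟩
  · rw [isStrictlyGE_iff]
    exact fun i hi ↦ F.map_isZero (K.isZero_of_isStrictlyGE a i hi)
  · rw [isStrictlyLE_iff]
    exact fun i hi ↦ F.map_isZero (K.isZero_of_isStrictlyLE b i hi)

theorem IsStrictlyPerfect.extendScalars {K : CochainComplex (ModuleCat.{w} R) ℤ}
    (hK : IsStrictlyPerfect K) :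
    IsStrictlyPerfect (((ModuleCat.extendScalars.{u, v, w} φ).mapHomologicalComplex _).obj K) := by
  refine ⟨hK.1.map _, fun i ↦ ?_⟩
  let _ := φ.toAlgebra
  have := (hK.2 i).1
  have := (hK.2 i).2
  exact ⟨(inferInstance : Module.Finite S (S ⊗[R] K.X i)),
    (inferInstance : Module.Projective S (S ⊗[R] K.X i))⟩

theorem homClass_finite [IsNoetherianRing R] {K G : CochainComplex (ModuleCat.{w} R) ℤ}
    (hK : IsStrictlyPerfect K) (hG : IsStrictlyPerfect G) : Module.Finite R (HomClass R K G) := by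
  obtain ⟨⟨a, b, _, _⟩, hK⟩ := hK
  have : Module.Finite R (Cochain K G 0) := by
    refine Module.Finite.pi_of_subsingleton _ (finite_triplet 0 a b)
      (M := fun t : Triplet 0 ↦ (K.X t.p ⟶ G.X t.q)) (fun t _ ↦ ?_) (fun t ht ↦ ?_)
    · have := (hK t.p).1
      have := (hK t.p).2
      have := (hG.2 t.q).1
      exact Module.Finite.equiv (ModuleCat.homLinearEquiv (S := R)
        (M := K.X t.p) (N := G.X t.q)).symm
    · exact ⟨fun x y ↦ (isZero_of_isStrictly K a b t.p ht).eq_of_src _ _⟩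
  infer_instance

/-- Over a Noetherian local ring with infinite residue field, a complex that becomes
quasi-isomorphic to a strictly perfect complex `K` after a faithfully flat base change receives a
quasi-isomorphism from `K`. -/
theorem exists_quasiIso_of_extendScalars [IsLocalRing R] [IsNoetherianRing R]
    [Infinite (IsLocalRing.ResidueField R)] (hφ : φ.FaithfullyFlat)
    (K G : CochainComplex (ModuleCat.{u} R) ℤ) (hK : IsStrictlyPerfect K)
    (h : QuasiIsomorphic
      (((ModuleCat.extendScalars.{u, v, u} φ).mapHomologicalComplex _).obj K)
      (((ModuleCat.extendScalars.{u, v, u} φ).mapHomologicalComplex _).obj G)) :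
    ∃ g : K ⟶ G, QuasiIso g := by
  let _ := φ.toAlgebra
  have : Module.FaithfullyFlat R S := hφ
  have : Module.Flat R S := hφ.flat
  let T := (ModuleCat.extendScalars.{u, v, u} φ).mapHomologicalComplex (.up ℤ)
  have : CochainComplex.IsKProjective (T.obj K) := (hK.extendScalars.{u, v, u} φ).isKProjective
  -- Over a local ring finite projective modules are free.
  have hf (i) : Module.Finite R (K.X i) ∧ Module.Free R (K.X i) := by
    have := (hK.2 i).1
    have := (hK.2 i).2
    exact ⟨inferInstance, Module.free_of_flat_of_isLocalRing⟩
  have : Module.Finite R (HomClass R K K) := homClass_finite hK hK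
  obtain ⟨ψ, _⟩ := h.exists_quasiIso
  obtain ⟨eK, heK⟩ := exists_homClass_equiv φ K K hφ.flat hK.1 hf
  obtain ⟨eG, heG⟩ := exists_homClass_equiv φ K G hφ.flat hK.1 hf
  obtain ⟨g, hg⟩ := exists_quasiIso_map_of_homClass_equiv (ModuleCat.extendScalars.{u, v, u} φ)
    eK heK eG heG ψ
  exact ⟨g, (quasiIso_extendScalars_map_iff.{u, v, u} φ hφ g).mp hg⟩

/-- **Hilbert 90** for strictly perfect complexes over a local ring. -/
theorem quasiIsomorphic_of_baseChangeComplex (R : Type u) [CommRing R] [IsLocalRing R]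
    [IsNoetherianRing R] [Infinite (IsLocalRing.ResidueField R)] (S : Type v) [CommRing S]
    [Algebra R S] [Module.FaithfullyFlat R S] (P Q : CochainComplex (ModuleCat.{u} R) ℤ)
    (hP : IsStrictlyPerfect P)
    (h : QuasiIsomorphic (baseChangeComplex S P) (baseChangeComplex S Q)) :
    QuasiIsomorphic P Q := by
  obtain ⟨g, _⟩ := exists_quasiIso_of_extendScalars (algebraMap R S)
    (RingHom.faithfullyFlat_algebraMap_iff.mpr inferInstance) P Q hP h
  exact .of_quasiIso g

end LocalForm

end

/-! ### Stalks of sheaves of modules. -/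

noncomputable section

lemma TopCat.Sheaf.preservesFiniteLimits_forget_comp_stalkFunctor (X : TopCat.{u}) (x : X) :
    Limits.PreservesFiniteLimits
      (TopCat.Sheaf.forget Ab.{u} X ⋙ TopCat.Presheaf.stalkFunctor Ab.{u} x) :=
  inferInstance

namespace AlgebraicGeometry.Scheme.Modules

open Opposite TopologicalSpace

variable {X : Scheme.{u}}

/-- The stalk at `x` of a sheaf of modules. -/
abbrev stalk (M : X.Modules) (x : X) : Ab.{u} :=
  TopCat.Presheaf.stalk (C := Ab.{u}) M.presheaf x

/-- The germ at `x` of a section of a sheaf of modules. -/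
abbrev germ (M : X.Modules) (U : X.Opens) (x : X) (hx : x ∈ U) :
    Γ(M, U) ⟶ M.stalk x :=
  TopCat.Presheaf.germ M.presheaf U x hx

instance moduleStalk (M : X.Modules) (x : X) :
    Module (X.presheaf.stalk x) (M.stalk x) :=
  PresheafOfModules.instModuleCarrierStalkCommRingCatCarrierAbPresheafOpensCarrier
    (R := X.presheaf) M.val x

lemma germ_smul (M : X.Modules) (U : X.Opens) (x : X) (hx : x ∈ U) (r : Γ(X, U)) (m : Γ(M, U)) :
    germ M U x hx (r • m) = X.presheaf.germ U x hx r • germ M U x hx m :=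
  PresheafOfModules.germ_smul (R := X.presheaf) M.val x U hx r m

/-- The additive map induced on stalks by a morphism of sheaves of modules. -/
def stalkAddHom {M N : X.Modules} (f : M ⟶ N) (x : X) : M.stalk x →+ N.stalk x :=
  ((TopCat.Presheaf.stalkFunctor Ab.{u} x).map f.mapPresheaf).hom

lemma stalkAddHom_germ {M N : X.Modules} (f : M ⟶ N) (U : X.Opens) (x : X) (hx : x ∈ U)
    (m : Γ(M, U)) : stalkAddHom f x (germ M U x hx m) = germ N U x hx (f.app U m) :=
  TopCat.Presheaf.stalkFunctor_map_germ_apply U x hx f.mapPresheaf m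

lemma exists_germ_eq (M : X.Modules) {x : X} (m : M.stalk x) :
    ∃ (U : X.Opens) (hx : x ∈ U) (s : Γ(M, U)), germ M U x hx s = m :=
  TopCat.Presheaf.exists_germ_eq M.presheaf m

lemma germ_res (M : X.Modules) {U V : X.Opens} (h : V ≤ U) {x : X} (hx : x ∈ V) (m : Γ(M, U)) :
    germ M V x hx (M.presheaf.map (homOfLE h).op m) = germ M U x (h hx) m :=
  TopCat.Presheaf.germ_res_apply M.presheaf (homOfLE h) x hx m

lemma exists_germ_eq_and_germ_eq (M : X.Modules) {x : X} (r : X.presheaf.stalk x)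
    (m : M.stalk x) : ∃ (U : X.Opens) (hx : x ∈ U) (r' : Γ(X, U)) (m' : Γ(M, U)),
      X.presheaf.germ U x hx r' = r ∧ germ M U x hx m' = m := by
  obtain ⟨U, hU, m, rfl⟩ := exists_germ_eq M m
  obtain ⟨V, hV, r, rfl⟩ := TopCat.Presheaf.exists_germ_eq X.presheaf r
  exact ⟨U ⊓ V, ⟨hU, hV⟩, X.presheaf.map (homOfLE inf_le_right).op r,
    M.presheaf.map (homOfLE inf_le_left).op m,
    TopCat.Presheaf.germ_res_apply X.presheaf (homOfLE inf_le_right) x ⟨hU, hV⟩ r,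
    germ_res M inf_le_left ⟨hU, hV⟩ m⟩

/-- The linear map induced on stalks by a morphism of sheaves of modules. -/
def stalkMap {M N : X.Modules} (f : M ⟶ N) (x : X) :
    M.stalk x →ₗ[X.presheaf.stalk x] N.stalk x where
  __ := stalkAddHom f x
  map_smul' r m := by
    obtain ⟨U, hU, r, m, rfl, rfl⟩ := exists_germ_eq_and_germ_eq M r m
    change stalkAddHom f x _ = _ • stalkAddHom f x _
    rw [← germ_smul, stalkAddHom_germ, stalkAddHom_germ, Hom.app_smul, germ_smul]
    rfl

lemma stalkMap_germ {M N : X.Modules} (f : M ⟶ N) (U : X.Opens) (x : X) (hx : x ∈ U)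
    (m : Γ(M, U)) : stalkMap f x (germ M U x hx m) = germ N U x hx (f.app U m) :=
  stalkAddHom_germ f U x hx m

/-- The stalk at a point, as a functor on sheaves of modules. -/
def stalkFunctor (x : X) : X.Modules ⥤ ModuleCat.{u} (X.presheaf.stalk x) where
  obj M := ModuleCat.of _ (M.stalk x)
  map f := ModuleCat.ofHom (stalkMap f x)
  map_id M := by
    ext m
    exact congr($((TopCat.Presheaf.stalkFunctor Ab.{u} x).map_id M.presheaf) m)
  map_comp f g := by
    ext m
    exact congr($((TopCat.Presheaf.stalkFunctor Ab.{u} x).map_comp f.mapPresheaf g.mapPresheaf) m)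

instance (x : X) : (stalkFunctor x).Additive where
  map_add {M N f g} := by
    ext m
    obtain ⟨U, hx, m, rfl⟩ := exists_germ_eq M m
    exact (stalkMap_germ (f + g) U x hx m).trans ((map_add _ _ _).trans
      (congrArg₂ _ (stalkMap_germ f U x hx m) (stalkMap_germ g U x hx m)).symm)

open Limits

/-- Checked on underlying abelian groups: finite limits are preserved in passing from sheaves of
modules to abelian sheaves and then to stalks. -/
instance (x : X) : PreservesFiniteLimits (stalkFunctor x) := by
  have : PreservesFiniteLimits (stalkFunctor x ⋙ forget₂ (ModuleCat _) Ab.{u}) := by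
    change PreservesFiniteLimits (SheafOfModules.toSheaf X.ringCatSheaf ⋙
      (TopCat.Sheaf.forget Ab.{u} X.toTopCat ⋙ TopCat.Presheaf.stalkFunctor Ab.{u} x))
    have h1 : PreservesFiniteLimits (SheafOfModules.toSheaf.{u} X.ringCatSheaf) := inferInstance
    have h2 : PreservesFiniteLimits (TopCat.Sheaf.forget Ab.{u} X.toTopCat ⋙
      TopCat.Presheaf.stalkFunctor Ab.{u} x) :=
      TopCat.Sheaf.preservesFiniteLimits_forget_comp_stalkFunctor _ x
    exact @comp_preservesFiniteLimits _ _ _ _ _ _ _ _ h1 h2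
  exact preservesFiniteLimits_of_reflects_of_preserves _ (forget₂ (ModuleCat _) Ab.{u})

lemma isIso_iff_stalkFunctor_map {M N : X.Modules} (f : M ⟶ N) :
    IsIso f ↔ ∀ x, IsIso ((stalkFunctor x).map f) := by
  let F : TopCat.Sheaf Ab.{u} X.toTopCat := ⟨M.presheaf, M.isSheaf⟩
  let G : TopCat.Sheaf Ab.{u} X.toTopCat := ⟨N.presheaf, N.isSheaf⟩
  let φ : F ⟶ G := ⟨f.mapPresheaf⟩
  refine ⟨fun _ x ↦ inferInstance, fun h ↦ ?_⟩
  have (x : X) : IsIso ((TopCat.Presheaf.stalkFunctor Ab.{u} x).map φ.hom) :=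
    inferInstanceAs (IsIso ((forget₂ (ModuleCat _) Ab.{u}).map ((stalkFunctor x).map f)))
  have h1 : IsIso φ := by
    exact TopCat.Presheaf.isIso_of_stalkFunctor_map_iso φ
  have : IsIso ((toPresheaf X).map f) :=
    inferInstanceAs (IsIso ((TopCat.Sheaf.forget Ab.{u} X.toTopCat).map φ))
  exact isIso_of_reflects_iso f (toPresheaf X)

end AlgebraicGeometry.Scheme.Modules

end

/-! ### Skyscraper sheaves and the stalks of a pullback. -/

noncomputable section

namespace AlgebraicGeometry.Scheme.Modules

open Opposite TopologicalSpace

variable {X Y : Scheme.{u}}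

lemma exists_germ_eq_of_le (M : X.Modules) {x : X} {O : X.Opens} (hO : x ∈ O) (m : M.stalk x) :
    ∃ (U : X.Opens) (_ : U ≤ O) (hx : x ∈ U) (s : Γ(M, U)), germ M U x hx s = m := by
  obtain ⟨U, hx, s, rfl⟩ := exists_germ_eq M m
  exact ⟨U ⊓ O, inf_le_right, ⟨hx, hO⟩, _, germ_res M inf_le_left ⟨hx, hO⟩ s⟩

lemma exists_res_eq_of_germ_eq (M : X.Modules) {x : X} {U V : X.Opens} (hU : x ∈ U) (hV : x ∈ V)
    (s : Γ(M, U)) (t : Γ(M, V)) (h : germ M U x hU s = germ M V x hV t) :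
    ∃ (W : X.Opens) (_ : x ∈ W) (hWU : W ≤ U) (hWV : W ≤ V),
      M.presheaf.map (homOfLE hWU).op s = M.presheaf.map (homOfLE hWV).op t := by
  obtain ⟨W, hW, i, j, e⟩ := TopCat.Presheaf.germ_eq M.presheaf x hU hV s t h
  exact ⟨W, hW, i.le, j.le, e⟩

/-- A compatible family of additive maps on the sections over the neighbourhoods of `x` in `O`,
linear over the germs of functions, factors through the stalk. -/
lemma exists_stalk_desc (M : X.Modules) {x : X} {O : X.Opens} (hO : x ∈ O)
    {N : Type*} [AddCommGroup N] [Module (X.presheaf.stalk x) N]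
    (φ : ∀ U : X.Opens, U ≤ O → x ∈ U → Γ(M, U) →+ N)
    (hsmul : ∀ U hU hx (r : Γ(X, U)) (m : Γ(M, U)),
      φ U hU hx (r • m) = X.presheaf.germ U x hx r • φ U hU hx m)
    (hres : ∀ U hU V (hV : V ≤ U) (hx : x ∈ V) (m : Γ(M, U)),
      φ V (hV.trans hU) hx (M.presheaf.map (homOfLE hV).op m) = φ U hU (hV hx) m) :
    ∃ f : M.stalk x →ₗ[X.presheaf.stalk x] N, ∀ U hU hx (m : Γ(M, U)),
      f (germ M U x hx m) = φ U hU hx m := by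
  -- The map is defined through an arbitrary choice of representatives; `key` shows that the value
  -- does not depend on it.
  choose U hUO hxU s hs using fun m : M.stalk x ↦ exists_germ_eq_of_le M hO m
  have key (V : X.Opens) (hV : V ≤ O) (hx : x ∈ V) (m : Γ(M, V)) (n : M.stalk x)
      (hn : germ M V x hx m = n) : φ (U n) (hUO n) (hxU n) (s n) = φ V hV hx m := by
    obtain ⟨W, hW, h₁, h₂, e⟩ := exists_res_eq_of_germ_eq M (hxU n) hx (s n) m
      ((hs n).trans hn.symm)
    rw [← hres _ _ W h₁ hW, ← hres _ _ W h₂ hW, e]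
  refine ⟨
    { toFun := fun m ↦ φ (U m) (hUO m) (hxU m) (s m)
      map_add' := fun m n ↦ ?_
      map_smul' := fun r m ↦ ?_ }, fun V hV hx m ↦ key V hV hx m _ rfl⟩
  · have hx : x ∈ U m ⊓ U n := ⟨hxU m, hxU n⟩
    rw [key (U m ⊓ U n) (inf_le_left.trans (hUO m)) hx
      (M.presheaf.map (homOfLE inf_le_left).op (s m) +
        M.presheaf.map (homOfLE inf_le_right).op (s n)) (m + n), map_add, hres, hres]
    rw [map_add, germ_res, germ_res, hs, hs]
  · obtain ⟨V, hx, r, hr⟩ := TopCat.Presheaf.exists_germ_eq X.presheaf r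
    have hxV : x ∈ U m ⊓ V := ⟨hxU m, hx⟩
    have h₁ : X.presheaf.germ (U m ⊓ V) x hxV (X.presheaf.map (homOfLE inf_le_right).op r) = _ :=
      (TopCat.Presheaf.germ_res_apply X.presheaf (homOfLE inf_le_right) x hxV r).trans hr
    rw [key (U m ⊓ V) (inf_le_left.trans (hUO m)) hxV
      ((show Γ(X, U m ⊓ V) from X.presheaf.map (homOfLE inf_le_right).op r) •
        M.presheaf.map (homOfLE inf_le_left).op (s m)) _, hsmul, hres, h₁]
    · rfl
    · rw [germ_smul, h₁, germ_res, hs]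

/-- A morphism of sheaves of modules from a compatible family of linear maps on sections. -/
def homMk {M N : X.Modules} (φ : ∀ U : X.Opens, Γ(M, U) →+ Γ(N, U))
    (hsmul : ∀ U (r : Γ(X, U)) (m : Γ(M, U)), φ U (r • m) = r • φ U m)
    (hres : ∀ U V (hV : V ≤ U) (m : Γ(M, U)),
      φ V (M.presheaf.map (homOfLE hV).op m) = N.presheaf.map (homOfLE hV).op (φ U m)) :
    M ⟶ N :=
  ⟨PresheafOfModules.homMk (M₁ := M.val) (M₂ := N.val)
    { app := fun U ↦ AddCommGrpCat.ofHom (φ U.unop)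
      naturality := fun U V i ↦ by
        ext m
        exact hres U.unop V.unop i.unop.le m } (fun U r m ↦ hsmul U.unop r m)⟩

section Skyscraper

variable (x : X)

/-- The sections of the skyscraper sheaf at `x` with value `N`. -/
def SkyscraperSections (N : ModuleCat.{u} (X.presheaf.stalk x)) (U : X.Opens) : Type u :=
  -- Functions on the proofs of `x ∈ U`: a copy of `N` if `x ∈ U` and a trivial group otherwise,
  -- without a case distinction.
  PLift (x ∈ U) → N

instance (N : ModuleCat.{u} (X.presheaf.stalk x)) (U : X.Opens) :
    AddCommGroup (SkyscraperSections x N U) :=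
  inferInstanceAs (AddCommGroup (PLift (x ∈ U) → N))

instance (N : ModuleCat.{u} (X.presheaf.stalk x)) (U : X.Opens) :
    Module Γ(X, U) (SkyscraperSections x N U) where
  smul r s := fun h ↦ X.presheaf.germ U x h.down r • s h
  one_smul s := funext fun h ↦ (congrArg (· • s h) (map_one _)).trans (one_smul _ _)
  mul_smul r t s := funext fun h ↦ (congrArg (· • s h) (map_mul _ r t)).trans (mul_smul _ _ _)
  smul_zero _ := funext fun _ ↦ smul_zero _
  smul_add _ _ _ := funext fun _ ↦ smul_add _ _ _
  add_smul r t s := funext fun h ↦ (congrArg (· • s h) (map_add _ r t)).trans (add_smul _ _ _)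
  zero_smul s := funext fun h ↦ (congrArg (· • s h) (map_zero _)).trans (zero_smul _ _)

/-- The skyscraper presheaf at `x` with value `N`. -/
def skyscraperAb (N : ModuleCat.{u} (X.presheaf.stalk x)) : TopCat.Presheaf Ab.{u} X where
  obj U := AddCommGrpCat.of (SkyscraperSections x N U.unop)
  map {U V} i := AddCommGrpCat.ofHom
    { toFun := fun s h ↦ s ⟨i.unop.le h.down⟩
      map_zero' := rfl
      map_add' := fun _ _ ↦ rfl }

lemma isSheaf_skyscraperAb (N : ModuleCat.{u} (X.presheaf.stalk x)) :
    (skyscraperAb x N).IsSheaf := by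
  rw [TopCat.Presheaf.isSheaf_iff_isSheafUniqueGluing]
  intro ι U sf hsf
  have key (i : ι) (h : x ∈ U i) (j : ι) (h' : x ∈ U j) :
      (show PLift (x ∈ U i) → N from sf i) ⟨h⟩ = (show PLift (x ∈ U j) → N from sf j) ⟨h'⟩ :=
    congrFun (show ((_ : PLift (x ∈ U i ⊓ U j) → N) = _) from hsf i j) ⟨h, h'⟩
  have mem (h : x ∈ iSup U) : ∃ i, x ∈ U i := by simpa using h
  refine ⟨fun h ↦ (show PLift (x ∈ U _) → N from sf (mem h.down).choose)
    ⟨(mem h.down).choose_spec⟩, fun i ↦ funext fun h ↦ key _ _ _ h.down, fun t ht ↦ ?_⟩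
  exact funext fun h ↦ congrFun (show ((_ : PLift (x ∈ U (mem h.down).choose) → N) = _)
    from ht (mem h.down).choose) ⟨(mem h.down).choose_spec⟩

/-- The skyscraper sheaf of modules. -/
def skyscraper (N : ModuleCat.{u} (X.presheaf.stalk x)) : X.Modules :=
  letI (U : (Opens X)ᵒᵖ) : Module (X.ringCatSheaf.obj.obj U) ((skyscraperAb x N).obj U) :=
    inferInstanceAs (Module Γ(X, U.unop) (SkyscraperSections x N U.unop))
  { val := PresheafOfModules.ofPresheaf (R := X.ringCatSheaf.obj) (skyscraperAb x N)
      (fun U _ i r s ↦ funext fun h ↦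
        congrArg (fun a : X.presheaf.stalk x ↦ a •
          (show PLift (x ∈ U.unop) → N from s) ⟨i.unop.le h.down⟩)
        (TopCat.Presheaf.germ_res_apply X.presheaf i.unop x h.down r).symm)
    isSheaf := isSheaf_skyscraperAb x N }

/-- The skyscraper functor at a point. -/
def skyscraperFunctor : ModuleCat.{u} (X.presheaf.stalk x) ⥤ X.Modules where
  obj := skyscraper x
  map {N N'} f := homMk (M := skyscraper x N) (N := skyscraper x N')
    (fun U ↦
      { toFun := fun s h ↦ f ((show SkyscraperSections x N U from s) h)
        map_zero' := funext fun _ ↦ map_zero f.hom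
        map_add' := fun _ _ ↦ funext fun _ ↦ map_add f.hom _ _ })
    (fun U r s ↦ funext fun _ ↦ _root_.map_smul f.hom _ _) (fun _ _ _ _ ↦ rfl)
  map_id N := by
    ext
    rfl
  map_comp f g := by
    ext
    rfl

/-- The value at the support of a section of a skyscraper sheaf. -/
def skyscraperEval (N : ModuleCat.{u} (X.presheaf.stalk x)) (U : X.Opens) (hx : x ∈ U) :
    Γ((skyscraperFunctor x).obj N, U) →+ N where
  toFun s := (show SkyscraperSections x N U from s) ⟨hx⟩
  map_zero' := rfl
  map_add' _ _ := rfl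

/-- The morphism to a skyscraper sheaf given by a linear map on the stalk. -/
def toSkyscraper {M : X.Modules} {N : ModuleCat.{u} (X.presheaf.stalk x)}
    (f : (stalkFunctor x).obj M ⟶ N) : M ⟶ (skyscraperFunctor x).obj N :=
  homMk (N := skyscraper x N)
    (fun U ↦
      { toFun := fun m h ↦ f (germ M U x h.down m)
        map_zero' := funext fun h ↦ (congrArg f (map_zero (germ M U x h.down).hom)).trans
          (map_zero f.hom)
        map_add' := fun m n ↦ funext fun h ↦
          (congrArg f (map_add (germ M U x h.down).hom m n)).trans (map_add f.hom _ _) })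
    (fun U r m ↦ funext fun h ↦ (congrArg f (germ_smul M U x h.down r m)).trans
      (_root_.map_smul f.hom _ _))
    (fun _ _ hV m ↦ funext fun h ↦ congrArg f (germ_res M hV h.down m))

/-- A morphism to the skyscraper sheaf is a compatible family of linear maps to `N` on the sections
over the neighbourhoods of `x`, that is, a linear map from the stalk. -/
lemma bijective_toSkyscraper (M : X.Modules) (N : ModuleCat.{u} (X.presheaf.stalk x)) :
    Function.Bijective (toSkyscraper x (M := M) (N := N)) := by
  refine ⟨fun f g h ↦ ?_, fun g ↦ ?_⟩
  · ext m
    obtain ⟨U, hx, m, rfl⟩ := exists_germ_eq M m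
    exact congr(skyscraperEval x N U hx (Hom.app $h U m))
  · obtain ⟨f, hf⟩ := exists_stalk_desc M (O := ⊤) trivial (N := N)
      (fun U _ hx ↦ (skyscraperEval x N U hx).comp (g.app U).hom)
      (fun U _ hx r m ↦ congrArg (skyscraperEval x N U hx) (g.app_smul r m))
      (fun U _ V hV hx m ↦ congrArg (skyscraperEval x N V hx)
        (congr($(g.mapPresheaf.naturality (homOfLE hV).op) m)))
    refine ⟨ModuleCat.ofHom f, ?_⟩
    ext U m
    exact funext fun h ↦ hf U le_top h.down m

lemma comp_toSkyscraper {M M' : X.Modules} (f : M ⟶ M') {N : ModuleCat.{u} (X.presheaf.stalk x)}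
    (g : (stalkFunctor x).obj M' ⟶ N) :
    f ≫ toSkyscraper x g = toSkyscraper x ((stalkFunctor x).map f ≫ g) := by
  ext U m
  exact funext fun h ↦ congrArg g (stalkMap_germ f U x h.down m).symm

/-- The stalk functor is left adjoint to the skyscraper functor. -/
def stalkSkyscraperAdjunction : stalkFunctor x ⊣ skyscraperFunctor x :=
  Adjunction.mkOfHomEquiv
    { homEquiv := fun M N ↦ Equiv.ofBijective (toSkyscraper x) (bijective_toSkyscraper x M N)
      homEquiv_naturality_left_symm := fun {M M' N} f g ↦ by
        rw [Equiv.symm_apply_eq, Equiv.ofBijective_apply, ← comp_toSkyscraper]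
        exact congrArg (f ≫ ·) ((Equiv.ofBijective (toSkyscraper x)
          (bijective_toSkyscraper x M' N)).apply_symm_apply g).symm
      homEquiv_naturality_right := fun {M N N'} f g ↦ by
        ext U m
        rfl }

end Skyscraper

section Pullback

variable (f : Y ⟶ X) (y : Y)

/-- The actions through `f` on sections and through `f.stalkMap y` on germs agree, since taking
germs commutes with `f`. -/
lemma pushforward_skyscraper_smul (N : ModuleCat.{u} (Y.presheaf.stalk y)) (U : X.Opens)
    (r : Γ(X, U)) (m : Γ((pushforward f).obj ((skyscraperFunctor y).obj N), U)) :
    (show SkyscraperSections y N (f ⁻¹ᵁ U) from r • m) =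
      (show SkyscraperSections (f y) ((ModuleCat.restrictScalars (f.stalkMap y).hom).obj N) U from
        r • (show SkyscraperSections (f y)
          ((ModuleCat.restrictScalars (f.stalkMap y).hom).obj N) U from m)) :=
  funext fun h ↦ congrArg (fun a : Y.presheaf.stalk y ↦ a •
    (show PLift (y ∈ f ⁻¹ᵁ U) → N from m) h) (f.germ_stalkMap_apply U y h.down r).symm

/-- The pushforward of a skyscraper sheaf is the skyscraper sheaf at the image point. -/
def skyscraperPushforwardIso :
    skyscraperFunctor y ⋙ pushforward f ≅
      ModuleCat.restrictScalars (f.stalkMap y).hom ⋙ skyscraperFunctor (f y) :=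
  NatIso.ofComponents
    (fun N ↦
      { hom := homMk (M := (pushforward f).obj ((skyscraperFunctor y).obj N))
          (N := (skyscraperFunctor (f y)).obj _)
          (fun U ↦ AddMonoidHom.id (SkyscraperSections y N (f ⁻¹ᵁ U))) (fun U r m ↦ pushforward_skyscraper_smul f y N U r m)
          (fun _ _ _ _ ↦ rfl)
        inv := homMk (N := (pushforward f).obj ((skyscraperFunctor y).obj N))
          (M := (skyscraperFunctor (f y)).obj _)
          (fun U ↦ AddMonoidHom.id (SkyscraperSections y N (f ⁻¹ᵁ U))) (fun U r m ↦ (pushforward_skyscraper_smul f y N U r m).symm)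
          (fun _ _ _ _ ↦ rfl)
        hom_inv_id := by
          ext
          rfl
        inv_hom_id := by
          ext
          rfl })
    (fun g ↦ by
      ext
      rfl)

/-- The stalk of a pullback is the base change of the stalk. -/
def pullbackStalkIso :
    pullback f ⋙ stalkFunctor y ≅
      stalkFunctor (f y) ⋙ ModuleCat.extendScalars (f.stalkMap y).hom :=
  -- The right adjoints of both sides agree, being the pushforward of a skyscraper and the
  -- skyscraper at the image point; left adjoints are unique.
  ((pullbackPushforwardAdjunction f).comp (stalkSkyscraperAdjunction y)).leftAdjointUniq
    (((stalkSkyscraperAdjunction (f y)).comp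
      (ModuleCat.extendRestrictScalarsAdj (f.stalkMap y).hom)).ofNatIsoRight
        (skyscraperPushforwardIso f y).symm)

end Pullback

end AlgebraicGeometry.Scheme.Modules

end

/-! ### Quasi-isomorphisms, stalks and flat pullback. -/

noncomputable section

attribute [local instance] HasDerivedCategory.standard in
theorem QuasiIsomorphic.exists_roof {C : Type u} [Category.{v} C] [Abelian C]
    {K L : CochainComplex C ℤ} (h : QuasiIsomorphic K L) :
    ∃ (M : CochainComplex C ℤ) (a : K ⟶ M) (s : L ⟶ M), QuasiIso a ∧ QuasiIso s := by
  obtain ⟨e⟩ := h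
  obtain ⟨M, a, s, hs, h⟩ := DerivedCategory.left_fac e.hom
  have ha : IsIso (DerivedCategory.Q.map a) := by
    have : DerivedCategory.Q.map a = e.hom ≫ DerivedCategory.Q.map s := by simp [h]
    rw [this]
    infer_instance
  exact ⟨M, a, s, (DerivedCategory.isIso_Q_map_iff_quasiIso C _).mp ha,
    (DerivedCategory.isIso_Q_map_iff_quasiIso C _).mp hs⟩

theorem QuasiIsomorphic.of_iso {C : Type u} [Category.{v} C] [Abelian C]
    {K L : CochainComplex C ℤ} (e : K ≅ L) : QuasiIsomorphic K L :=
  .of_quasiIso e.hom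

/-- A roof of quasi-isomorphisms is sent to a roof. The hypothesis is preservation of
quasi-isomorphisms rather than exactness, as that is what is checked on stalks for a flat pullback.
-/
theorem QuasiIsomorphic.map {C : Type*} [Category* C] [Abelian C] {D : Type*} [Category* D]
    [Abelian D] (F : C ⥤ D) [F.Additive]
    (hF : ∀ ⦃K L : CochainComplex C ℤ⦄ (f : K ⟶ L), QuasiIso f →
      QuasiIso ((F.mapHomologicalComplex _).map f))
    {K L : CochainComplex C ℤ} (h : QuasiIsomorphic K L) :
    QuasiIsomorphic ((F.mapHomologicalComplex _).obj K) ((F.mapHomologicalComplex _).obj L) := by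
  obtain ⟨M, a, s, ha, hs⟩ := h.exists_roof
  have := hF a ha
  have := hF s hs
  exact (QuasiIsomorphic.of_quasiIso ((F.mapHomologicalComplex _).map a)).trans
    (QuasiIsomorphic.of_quasiIso ((F.mapHomologicalComplex _).map s)).symm

theorem quasiIsoAt_map_iff_isIso_map_homologyMap {C D ι : Type*} [Category* C] [Category* D]
    [Abelian C] [Abelian D] {c : ComplexShape ι} (F : C ⥤ D) [F.Additive] [F.PreservesHomology]
    {K L : HomologicalComplex C c} (f : K ⟶ L) (i : ι) :
    QuasiIsoAt ((F.mapHomologicalComplex c).map f) i ↔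
      IsIso (F.map (HomologicalComplex.homologyMap f i)) := by
  rw [quasiIsoAt_iff_isIso_homologyMap]
  exact (MorphismProperty.isomorphisms D).arrow_mk_iso_iff
    (Arrow.isoMk ((K.sc i).mapHomologyIso F) ((L.sc i).mapHomologyIso F)
      (ShortComplex.mapHomologyIso_hom_naturality
        ((HomologicalComplex.shortComplexFunctor C c i).map f) F).symm)

/-- Quasi-isomorphisms are stable under isomorphisms of arrows. -/
theorem quasiIso_map_iff_of_natIso {C D ι : Type*} [Category* C] [Category* D]
    [Preadditive C] [Abelian D] {c : ComplexShape ι} {F G : C ⥤ D} [F.Additive] [G.Additive]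
    (e : F ≅ G) {K L : HomologicalComplex C c} (f : K ⟶ L) :
    QuasiIso ((F.mapHomologicalComplex c).map f) ↔ QuasiIso ((G.mapHomologicalComplex c).map f) :=
  quasiIso_iff_of_arrow_mk_iso _ _ (Arrow.isoMk
    ((NatIso.mapHomologicalComplex e c).app K) ((NatIso.mapHomologicalComplex e c).app L)
    ((NatIso.mapHomologicalComplex e c).hom.naturality f).symm)

namespace AlgebraicGeometry.Scheme.Modules

variable {X Y Z : Scheme.{u}}

/-- The complex of stalks at a point of a complex of sheaves of modules. -/
abbrev stalkComplex (x : X) :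
    CochainComplex X.Modules ℤ ⥤ CochainComplex (ModuleCat.{u} (X.presheaf.stalk x)) ℤ :=
  (stalkFunctor x).mapHomologicalComplex _

instance (x : X) : (stalkFunctor x).PreservesHomology := by
  -- Right exactness of stalks comes from their being a left adjoint, left exactness from the
  -- instance above.
  have := (stalkSkyscraperAdjunction x).leftAdjoint_preservesColimits
  infer_instance

theorem quasiIso_iff_stalkComplex_map {K L : CochainComplex X.Modules ℤ} (f : K ⟶ L) :
    QuasiIso f ↔ ∀ x, QuasiIso ((stalkComplex x).map f) := by
  simp_rw [quasiIso_iff, quasiIsoAt_map_iff_isIso_map_homologyMap, quasiIsoAt_iff_isIso_homologyMap,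
    isIso_iff_stalkFunctor_map]
  exact forall_comm

/-- The termwise pullback of complexes. -/
abbrev pullbackFunctor (f : Y ⟶ X) : CochainComplex X.Modules ℤ ⥤ CochainComplex Y.Modules ℤ :=
  (pullback f).mapHomologicalComplex _

theorem quasiIso_stalkComplex_map_pullbackFunctor_map_iff (f : Y ⟶ X) (y : Y)
    {K L : CochainComplex X.Modules ℤ} (g : K ⟶ L) :
    QuasiIso ((stalkComplex y).map ((pullbackFunctor f).map g)) ↔
      QuasiIso (((ModuleCat.extendScalars (f.stalkMap y).hom).mapHomologicalComplex _).map
        ((stalkComplex (f y)).map g)) :=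
  quasiIso_map_iff_of_natIso (pullbackStalkIso f y) g

theorem faithfullyFlat_stalkMap (f : Y ⟶ X) [Flat f] (y : Y) :
    (f.stalkMap y).hom.FaithfullyFlat := by
  algebraize [(f.stalkMap y).hom]
  exact @Module.FaithfullyFlat.of_flat_of_isLocalHom _ _ _ _ _ _ _
      (Flat.stalkMap f y) (f.toLRSHom.prop y)

/-- The stalk maps of a flat morphism are flat and local, hence faithfully flat. The forward
direction is the descent used at the end of the scheme form. -/
theorem quasiIso_stalkComplex_map_pullbackFunctor_map_iff_of_flat (f : Y ⟶ X) [Flat f] (y : Y)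
    {K L : CochainComplex X.Modules ℤ} (g : K ⟶ L) :
    QuasiIso ((stalkComplex y).map ((pullbackFunctor f).map g)) ↔
      QuasiIso ((stalkComplex (f y)).map g) :=
  (quasiIso_stalkComplex_map_pullbackFunctor_map_iff f y g).trans
    (quasiIso_extendScalars_map_iff _ (faithfullyFlat_stalkMap f y) _)

theorem quasiIso_pullbackFunctor_map (f : Y ⟶ X) [Flat f] {K L : CochainComplex X.Modules ℤ}
    (g : K ⟶ L) (hg : QuasiIso g) : QuasiIso ((pullbackFunctor f).map g) := by
  rw [quasiIso_iff_stalkComplex_map] at hg ⊢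
  exact fun y ↦ (quasiIso_stalkComplex_map_pullbackFunctor_map_iff_of_flat f y g).mpr (hg _)

theorem _root_.QuasiIsomorphic.pullbackComplex (f : Y ⟶ X) [Flat f]
    {K L : CochainComplex X.Modules ℤ} (h : QuasiIsomorphic K L) :
    QuasiIsomorphic (pullbackComplex f K) (pullbackComplex f L) :=
  h.map _ fun _ _ g ↦ quasiIso_pullbackFunctor_map f g

theorem _root_.QuasiIsomorphic.stalkComplex (x : X)
    {K L : CochainComplex X.Modules ℤ} (h : QuasiIsomorphic K L) :
    QuasiIsomorphic ((stalkComplex x).obj K) ((stalkComplex x).obj L) :=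
  h.map _ fun _ _ _ hg ↦ (quasiIso_iff_stalkComplex_map _).mp hg x

/-- The iterated pullback of a complex is its pullback along the composition. -/
def pullbackComplexComp (f : Z ⟶ Y) (g : Y ⟶ X) (K : CochainComplex X.Modules ℤ) :
    pullbackComplex f (pullbackComplex g K) ≅ pullbackComplex (f ≫ g) K :=
  (NatIso.mapHomologicalComplex (pullbackComp f g) _).app K

/-- The stalk of the pullback of a complex is the base change of its stalk. -/
def pullbackComplexStalkIso (f : Y ⟶ X) (y : Y) (K : CochainComplex X.Modules ℤ) :
    (stalkComplex y).obj (pullbackComplex f K) ≅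
      ((ModuleCat.extendScalars (f.stalkMap y).hom).mapHomologicalComplex _).obj
        ((stalkComplex (f y)).obj K) :=
  (NatIso.mapHomologicalComplex (pullbackStalkIso f y) _).app K

end AlgebraicGeometry.Scheme.Modules

end

/-! ### Retracts of finite free sheaves of modules. -/

noncomputable section

namespace AlgebraicGeometry.Scheme.Modules

open Opposite TopologicalSpace

variable {X Y : Scheme.{u}}

/-- The structure sheaf as a sheaf of modules. -/
def unit (X : Scheme.{u}) : X.Modules := SheafOfModules.unit X.ringCatSheaf

/-- A sheaf of modules has a finite dual basis if it is a retract of a finite free one. -/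
def HasDualBasis (L : X.Modules) : Prop :=
  ∃ (n : ℕ) (e : Fin n → (unit X ⟶ L)) (p : Fin n → (L ⟶ unit X)), ∑ i, p i ≫ e i = 𝟙 L

lemma HasDualBasis.of_iso {L M : X.Modules} (h : HasDualBasis M) (α : L ≅ M) :
    HasDualBasis L := by
  obtain ⟨n, e, p, h⟩ := h
  refine ⟨n, fun i ↦ e i ≫ α.inv, fun i ↦ α.hom ≫ p i, ?_⟩
  have : ∀ i, (α.hom ≫ p i) ≫ e i ≫ α.inv = α.hom ≫ (p i ≫ e i) ≫ α.inv := by simp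
  simp_rw [this, ← Preadditive.comp_sum, ← Preadditive.sum_comp, h]
  simp

/-- The relation `∑ p i ≫ e i = 𝟙` survives every additive functor that fixes the structure sheaf.
For this reason dual bases replace freeness: pullbacks of free sheaves need not be computed. -/
lemma HasDualBasis.map {L : X.Modules} (h : HasDualBasis L) (F : X.Modules ⥤ Y.Modules)
    [F.Additive] (α : F.obj (unit X) ≅ unit Y) : HasDualBasis (F.obj L) := by
  obtain ⟨n, e, p, h⟩ := h
  refine ⟨n, fun i ↦ α.inv ≫ F.map (e i), fun i ↦ F.map (p i) ≫ α.hom, ?_⟩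
  simp [← Functor.map_comp, ← Functor.map_sum, h]

lemma hasDualBasis_of_isColimit {n : ℕ} {ι : Type*} (σ : ι ≃ Fin n)
    {c : Limits.Cofan fun _ : ι ↦ unit X} (hc : Limits.IsColimit c) : HasDualBasis c.pt := by
  classical
  refine ⟨n, fun i ↦ c.inj (σ.symm i), fun i ↦ Limits.Cofan.IsColimit.desc hc
    fun j ↦ if i = σ j then 𝟙 _ else 0, Limits.Cofan.IsColimit.hom_ext hc _ _ fun j ↦ ?_⟩
  rw [Preadditive.comp_sum, Finset.sum_eq_single (σ j)]
  · simp
  · intro i _ hi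
    simp [hi]
  · simp

lemma _root_.IsFiniteFree.hasDualBasis {L : X.Modules} (h : IsFiniteFree L) : HasDualBasis L := by
  obtain ⟨n, ⟨α⟩⟩ := h
  exact HasDualBasis.of_iso (hasDualBasis_of_isColimit (X := X) Equiv.ulift
    (SheafOfModules.isColimitFreeCofan (R := X.ringCatSheaf) (ULift.{u} (Fin n)))) α

lemma final_opensMap (f : Y ⟶ X) : (Opens.map f.base).Final := by
  refine Functor.final_of_exists_of_isFiltered _ (fun U ↦ ⟨⊤, ⟨homOfLE le_top⟩⟩)
    fun {U V} s t ↦ ⟨V, 𝟙 _, Subsingleton.elim _ _⟩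

/-- The pullback of the structure sheaf is the structure sheaf. -/
def pullbackUnitIso (f : Y ⟶ X) : (pullback f).obj (unit X) ≅ unit Y :=
  letI := final_opensMap f
  letI : (SheafOfModules.pushforward.{u} f.toRingCatSheafHom).IsRightAdjoint :=
    inferInstanceAs (pushforward f).IsRightAdjoint
  @asIso (SheafOfModules.{u} Y.ringCatSheaf) _ _ _
    (SheafOfModules.pullbackObjUnitToUnit.{u} f.toRingCatSheafHom)
    (SheafOfModules.instIsIsoPullbackObjUnitToUnitOfFinal f.toRingCatSheafHom)

lemma HasDualBasis.pullback {L : X.Modules} (h : HasDualBasis L) (f : Y ⟶ X) :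
    HasDualBasis ((pullback f).obj L) :=
  h.map _ (pullbackUnitIso f)

variable {L : X.Modules}

/-- The function attached to a section by a morphism to the structure sheaf. -/
def formApp (p : L ⟶ unit X) (U : X.Opens) (l : Γ(L, U)) : Γ(X, U) := p.app U l

lemma HasDualBasis.exists_sections (h : HasDualBasis L) :
    ∃ (n : ℕ) (e : Fin n → Γ(L, ⊤)) (p : Fin n → (L ⟶ unit X)), ∀ U (l : Γ(L, U)),
      l = ∑ i, formApp (p i) U l • L.presheaf.map (homOfLE le_top).op (e i) := by
  obtain ⟨n, e, p, h⟩ := h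
  refine ⟨n, fun i ↦ (e i).app ⊤ (1 : Γ(X, ⊤)), p, fun U l ↦ ?_⟩
  -- A morphism out of the structure sheaf is multiplication of the image of the global section 1.
  have key (i : Fin n) (r : Γ(X, U)) : (e i).app U r =
      r • L.presheaf.map (homOfLE le_top).op ((e i).app ⊤ (1 : Γ(X, ⊤))) := by
    have h1 : (e i).app U (1 : Γ(X, U)) =
        L.presheaf.map (homOfLE le_top).op ((e i).app ⊤ (1 : Γ(X, ⊤))) := by
      have := congr($((e i).mapPresheaf.naturality (homOfLE (le_top : U ≤ ⊤)).op) (1 : Γ(X, ⊤)))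
      refine Eq.trans (congrArg ((e i).app U) ?_) this
      exact (map_one (X.presheaf.map (homOfLE (le_top : U ≤ ⊤)).op).hom).symm
    have h2 := (e i).app_smul r (show Γ(unit X, U) from (1 : Γ(X, U)))
    rw [← h1]
    refine Eq.trans (congrArg ((e i).app U) ?_) h2
    exact (mul_one r).symm
  have sum_app (s : Finset (Fin n)) :
      (∑ i ∈ s, p i ≫ e i).app U l = ∑ i ∈ s, (e i).app U ((p i).app U l) := by
    classical
    induction s using Finset.induction_on with
    | empty => rfl
    | insert i s hi ih =>
      rw [Finset.sum_insert hi, Finset.sum_insert hi, ← ih]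
      rfl
  exact (congr(Hom.app $h U l)).symm.trans ((sum_app _).trans
    (Finset.sum_congr rfl fun i _ ↦ key i _))

/-- The linear form on stalks induced by a morphism to the structure sheaf. -/
lemma exists_stalk_form (p : L ⟶ unit X) (x : X) :
    ∃ f : L.stalk x →ₗ[X.presheaf.stalk x] X.presheaf.stalk x, ∀ U hx (l : Γ(L, U)),
      f (germ L U x hx l) = X.presheaf.germ U x hx (formApp p U l) := by
  obtain ⟨f, hf⟩ := exists_stalk_desc L (O := ⊤) (x := x) trivial (N := X.presheaf.stalk x)
    (fun U _ hx ↦ (X.presheaf.germ U x hx).hom.toAddMonoidHom.comp (p.app U).hom)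
    (fun U _ hx r m ↦ (congrArg (X.presheaf.germ U x hx) (p.app_smul r m)).trans
      (map_mul (X.presheaf.germ U x hx).hom r _))
    (fun U _ V hV hx m ↦ (congrArg (X.presheaf.germ V x hx)
      (congr($(p.mapPresheaf.naturality (homOfLE hV).op) m))).trans
      (TopCat.Presheaf.germ_res_apply X.presheaf (homOfLE hV) x hx _))
  exact ⟨f, fun U hx l ↦ hf U le_top hx l⟩

lemma HasDualBasis.exists_stalk_dualBasis (h : HasDualBasis L) (x : X) :
    ∃ (n : ℕ) (e : Fin n → L.stalk x) (p : Fin n → (L.stalk x →ₗ[X.presheaf.stalk x]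
      X.presheaf.stalk x)), ∀ l, l = ∑ i, p i l • e i := by
  obtain ⟨n, e, p, h⟩ := h.exists_sections
  choose q hq using fun i ↦ exists_stalk_form (p i) x
  refine ⟨n, fun i ↦ germ L ⊤ x trivial (e i), q, fun l ↦ ?_⟩
  obtain ⟨U, hx, l, rfl⟩ := exists_germ_eq L l
  conv_lhs => rw [h U l, map_sum]
  refine Finset.sum_congr rfl fun i _ ↦ ?_
  rw [germ_smul, hq, germ_res]

end AlgebraicGeometry.Scheme.Modules

lemma Module.finite_and_projective_of_dualBasis {R M : Type*} [CommRing R] [AddCommGroup M]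
    [Module R M] {n : ℕ} (e : Fin n → M) (p : Fin n → (M →ₗ[R] R))
    (h : ∀ m, m = ∑ i, p i m • e i) : Module.Finite R M ∧ Module.Projective R M := by
  have hs : Fintype.linearCombination R e ∘ₗ LinearMap.pi p = LinearMap.id := by
    ext m
    simpa [Fintype.linearCombination_apply] using (h m).symm
  exact ⟨.of_surjective (Fintype.linearCombination R e) fun m ↦ ⟨_, congr($hs m)⟩,
    .of_split (LinearMap.pi p) (Fintype.linearCombination R e) hs⟩

namespace AlgebraicGeometry.Scheme.Modules

variable {X : Scheme.{u}}

/-- A bounded complex of sheaves with finite dual bases. -/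
def IsBoundedDual (K : CochainComplex X.Modules ℤ) : Prop :=
  IsBoundedComplex K ∧ ∀ i, HasDualBasis (K.X i)

lemma IsBoundedDual.isStrictlyPerfect {K : CochainComplex X.Modules ℤ} (hK : IsBoundedDual K)
    (x : X) : IsStrictlyPerfect ((stalkComplex x).obj K) := by
  refine ⟨hK.1.map (stalkFunctor x), fun i ↦ ?_⟩
  obtain ⟨n, e, p, h⟩ := (hK.2 i).exists_stalk_dualBasis x
  exact Module.finite_and_projective_of_dualBasis e p h

lemma IsBoundedDual.pullback {Y : Scheme.{u}} {K : CochainComplex X.Modules ℤ}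
    (hK : IsBoundedDual K) (f : Y ⟶ X) : IsBoundedDual (pullbackComplex f K) :=
  ⟨hK.1.map (Modules.pullback f), fun i ↦ (hK.2 i).pullback f⟩

end AlgebraicGeometry.Scheme.Modules

end

/-! ### Morphisms over a neighbourhood of a point. -/

noncomputable section

namespace AlgebraicGeometry.Scheme.Modules

open Opposite TopologicalSpace

variable {X : Scheme.{u}}

/-- The category of sheaves of modules on `X` with the morphisms of their restrictions to `O`. -/
structure Loc (O : X.Opens) : Type (u + 1) where
  /-- The underlying sheaf of modules. -/
  sheaf : X.Modules

/-- The morphisms between the restrictions of two sheaves of modules to an open subset `O`, as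
compatible families of linear maps on the sections over the open subsets of `O`. -/
def localHoms (O : X.Opens) (L M : X.Modules) :
    AddSubgroup (∀ U : {U : X.Opens // U ≤ O}, (Γ(L, U.1) →+ Γ(M, U.1))) where
  carrier := {φ | (∀ U hU (r : Γ(X, U)) (m : Γ(L, U)), φ ⟨U, hU⟩ (r • m) = r • φ ⟨U, hU⟩ m) ∧
    ∀ U hU V (hV : V ≤ U) (m : Γ(L, U)), φ ⟨V, hV.trans hU⟩ (L.presheaf.map (homOfLE hV).op m) =
      M.presheaf.map (homOfLE hV).op (φ ⟨U, hU⟩ m)}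
  zero_mem' := ⟨fun U _ r _ ↦ (smul_zero (A := Γ(M, U)) r).symm, fun _ _ _ _ _ ↦ (map_zero _).symm⟩
  add_mem' {φ ψ} hφ hψ := ⟨fun U hU r m ↦ (congrArg₂ (· + ·) (hφ.1 U hU r m) (hψ.1 U hU r m)).trans
      (smul_add r (φ ⟨U, hU⟩ m) (ψ ⟨U, hU⟩ m)).symm,
    fun U hU V hV m ↦ (congrArg₂ (· + ·) (hφ.2 U hU V hV m) (hψ.2 U hU V hV m)).trans
      (map_add _ (φ ⟨U, hU⟩ m) (ψ ⟨U, hU⟩ m)).symm⟩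
  neg_mem' {φ} hφ := ⟨fun U hU r m ↦ (congrArg (- ·) (hφ.1 U hU r m)).trans
      (smul_neg r (φ ⟨U, hU⟩ m)).symm,
    fun U hU V hV m ↦ (congrArg (- ·) (hφ.2 U hU V hV m)).trans (map_neg _ (φ ⟨U, hU⟩ m)).symm⟩

namespace Loc

variable {O : X.Opens}

/-- Objects remain sheaves on `X`, so shrinking `O` changes neither sections nor stalks and requires
no comparison of restricted sheaves. The additive structure is enough to speak of cochains and `δ`.
-/
instance : Category (Loc O) where
  Hom L M := localHoms O L.sheaf M.sheaf
  id L := ⟨fun _ ↦ AddMonoidHom.id _, fun _ _ _ _ ↦ rfl, fun _ _ _ _ _ ↦ rfl⟩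
  comp {L M N} φ ψ := ⟨fun U ↦ (ψ.1 U).comp (φ.1 U),
    fun U hU r m ↦ (congrArg (ψ.1 ⟨U, hU⟩) (φ.2.1 U hU r m)).trans (ψ.2.1 U hU r _),
    fun U hU V hV m ↦ (congrArg (ψ.1 ⟨V, _⟩) (φ.2.2 U hU V hV m)).trans (ψ.2.2 U hU V hV _)⟩

/-- The action of a morphism over `O` on the sections over an open subset of `O`. -/
def app {L M : Loc O} (φ : L ⟶ M) (U : X.Opens) (hU : U ≤ O) :
    Γ(L.sheaf, U) →+ Γ(M.sheaf, U) :=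
  φ.1 ⟨U, hU⟩

lemma hom_ext {L M : Loc O} {φ ψ : L ⟶ M} (h : ∀ U hU, app φ U hU = app ψ U hU) : φ = ψ :=
  Subtype.ext (funext fun U ↦ h U.1 U.2)

instance : Preadditive (Loc O) where
  homGroup L M := inferInstanceAs (AddCommGroup (localHoms O L.sheaf M.sheaf))
  add_comp _ _ _ φ ψ χ := hom_ext fun U hU ↦ AddMonoidHom.ext fun m ↦
    map_add (app χ U hU) (app φ U hU m) (app ψ U hU m)
  comp_add _ _ _ _ _ _ := rfl

/-- Restriction to an open subset. -/
def ofModules (O : X.Opens) : X.Modules ⥤ Loc O where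
  obj L := ⟨L⟩
  map f := ⟨fun U ↦ (f.app U.1).hom, fun U _ r m ↦ f.app_smul r m,
    fun U _ V hV m ↦ congr($(f.mapPresheaf.naturality (homOfLE hV).op) m)⟩

instance : (ofModules O).Additive where
  map_add := rfl

/-- Restriction of a morphism to a smaller open subset. -/
def res {O' : X.Opens} (h : O' ≤ O) {L M : X.Modules}
    (φ : (ofModules O).obj L ⟶ (ofModules O).obj M) :
    (ofModules O').obj L ⟶ (ofModules O').obj M :=
  ⟨fun U ↦ φ.1 ⟨U.1, U.2.trans h⟩, fun U hU ↦ φ.2.1 U (hU.trans h),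
    fun U hU ↦ φ.2.2 U (hU.trans h)⟩

lemma app_sum {L M : Loc O} {ι : Type*} (s : Finset ι) (φ : ι → (L ⟶ M)) (U : X.Opens)
    (hU : U ≤ O) (l : Γ(L.sheaf, U)) :
    app (∑ i ∈ s, φ i) U hU l = ∑ i ∈ s, app (φ i) U hU l := by
  classical
  induction s using Finset.induction_on with
  | empty => rfl
  | insert i s hi ih =>
    rw [Finset.sum_insert hi, Finset.sum_insert hi, ← ih]
    rfl

/-- The morphism from the structure sheaf given by a section. -/
def ofSection {M : X.Modules} (m : Γ(M, O)) :
    (ofModules O).obj (unit X) ⟶ (ofModules O).obj M :=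
  ⟨fun U ↦
    { toFun := fun r ↦ (show Γ(X, U.1) from r) • M.presheaf.map (homOfLE U.2).op m
      map_zero' := zero_smul Γ(X, U.1) (M.presheaf.map (homOfLE U.2).op m)
      map_add' := fun r t ↦ add_smul (show Γ(X, U.1) from r) (show Γ(X, U.1) from t)
        (M.presheaf.map (homOfLE U.2).op m) },
    fun U hU r t ↦ mul_smul r (show Γ(X, U) from t) (M.presheaf.map (homOfLE hU).op m),
    fun U hU V hV r ↦ by
      have h₁ := M.map_smul (homOfLE hV) (show Γ(X, U) from r) (M.presheaf.map (homOfLE hU).op m)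
      have h₂ : M.presheaf.map (homOfLE (hV.trans hU)).op m =
          M.presheaf.map (homOfLE hV).op (M.presheaf.map (homOfLE hU).op m) :=
        congr($(M.presheaf.map_comp (homOfLE hU).op (homOfLE hV).op) m)
      rw [← h₂] at h₁
      exact h₁.symm⟩

variable {x : X} (hx : x ∈ O)

include hx in
lemma exists_stalkMap {L M : Loc O} (φ : L ⟶ M) :
    ∃ f : Modules.stalk L.sheaf x →ₗ[X.presheaf.stalk x] Modules.stalk M.sheaf x, ∀ U hU hx m,
      f (germ L.sheaf U x hx m) =
        germ M.sheaf U x hx (app φ U hU m) :=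
  exists_stalk_desc L.sheaf hx
    (fun U hU hx ↦ (germ M.sheaf U x hx).hom.comp (app φ U hU))
    (fun U hU hx r m ↦ (congrArg (germ M.sheaf U x hx) (φ.2.1 U hU r m)).trans
      (germ_smul M.sheaf U x hx r _))
    (fun U hU V hV hx m ↦ (congrArg (germ M.sheaf V x hx)
      (φ.2.2 U hU V hV m)).trans (germ_res M.sheaf hV hx _))

/-- The map induced on stalks by a morphism over a neighbourhood. -/
def stalkMap {L M : Loc O} (φ : L ⟶ M) :
    Modules.stalk L.sheaf x →ₗ[X.presheaf.stalk x] Modules.stalk M.sheaf x :=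
  (exists_stalkMap hx φ).choose

lemma stalkMap_germ {L M : Loc O} (φ : L ⟶ M) (U : X.Opens) (hU : U ≤ O) (hxU : x ∈ U)
    (m : Γ(L.sheaf, U)) :
    stalkMap hx φ (germ L.sheaf U x hxU m) =
      germ M.sheaf U x hxU (app φ U hU m) :=
  (exists_stalkMap hx φ).choose_spec U hU hxU m

include hx in
lemma stalk_hom_ext {L : X.Modules} {N : Type*} {f g : L.stalk x → N}
    (h : ∀ U (_ : U ≤ O) hxU m, f (germ L U x hxU m) = g (germ L U x hxU m)) : f = g := by
  funext m
  obtain ⟨U, hU, hxU, m, rfl⟩ := exists_germ_eq_of_le L hx m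
  exact h U hU hxU m

/-- The stalk functor on sheaves over a neighbourhood. -/
def stalkFunctor : Loc O ⥤ ModuleCat.{u} (X.presheaf.stalk x) where
  obj L := (Modules.stalkFunctor x).obj L.sheaf
  map φ := ModuleCat.ofHom (stalkMap hx φ)
  map_id _ := ModuleCat.hom_ext (LinearMap.ext (congrFun (stalk_hom_ext hx
    fun U hU hxU m ↦ stalkMap_germ hx (𝟙 _) U hU hxU m)))
  map_comp φ ψ := ModuleCat.hom_ext (LinearMap.ext (congrFun (stalk_hom_ext hx
    fun U hU hxU m ↦ (stalkMap_germ hx (φ ≫ ψ) U hU hxU m).trans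
      ((congrArg (stalkMap hx ψ) (stalkMap_germ hx φ U hU hxU m)).trans
        (stalkMap_germ hx ψ U hU hxU _)).symm)))

instance : (stalkFunctor hx).Additive where
  map_add {_ M φ ψ} := ModuleCat.hom_ext (LinearMap.ext (congrFun (stalk_hom_ext hx
    fun U hU hxU m ↦ (stalkMap_germ hx (φ + ψ) U hU hxU m).trans
      ((map_add (germ M.sheaf U x hxU).hom _ _).trans
        (congrArg₂ (· + ·) (stalkMap_germ hx φ U hU hxU m)
          (stalkMap_germ hx ψ U hU hxU m)).symm))))

lemma stalkFunctor_map_ofModules_map {L M : X.Modules} (f : L ⟶ M) :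
    (stalkFunctor hx).map ((ofModules O).map f) = (Modules.stalkFunctor x).map f :=
  ModuleCat.hom_ext (LinearMap.ext (congrFun (stalk_hom_ext hx
    fun U hU hxU m ↦ (stalkMap_germ hx ((ofModules O).map f) U hU hxU m).trans
      (Modules.stalkMap_germ f U x hxU m).symm)))

lemma stalkFunctor_map_res {O' : X.Opens} (h : O' ≤ O) (hx' : x ∈ O') {L M : X.Modules}
    (φ : (ofModules O).obj L ⟶ (ofModules O).obj M) :
    (stalkFunctor hx').map (res h φ) = (stalkFunctor hx).map φ :=
  ModuleCat.hom_ext (LinearMap.ext (congrFun (stalk_hom_ext hx'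
    fun U hU hxU m ↦ (stalkMap_germ hx' (res h φ) U hU hxU m).trans
      (stalkMap_germ hx φ U (hU.trans h) hxU m).symm)))

lemma stalkFunctor_map_eq_zero {O' : X.Opens} (h : O' ≤ O) (hx' : x ∈ O') {L M : X.Modules}
    (φ : (ofModules O).obj L ⟶ (ofModules O).obj M)
    (hφ : ∀ U (hU : U ≤ O'), app φ U (hU.trans h) = 0) : (stalkFunctor hx).map φ = 0 :=
  ModuleCat.hom_ext (LinearMap.ext (congrFun (stalk_hom_ext hx'
    fun U hU hxU m ↦ (stalkMap_germ hx φ U (hU.trans h) hxU m).trans (by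
      rw [hφ U hU]
      exact map_zero (germ M U x hxU).hom))))

end Loc

/-- Intersects finitely many neighbourhoods. It serves for the members of a dual basis as well as
for the components of a cochain on a bounded complex. -/
lemma exists_forall_of_finite {ι : Type*} (P : ι → X.Opens → Prop)
    (hP : ∀ i O O', O' ≤ O → P i O → P i O') {S : Set ι} (hS : S.Finite) (h : ∀ i ∉ S, P i ⊤)
    {x : X} (hx : ∀ i, ∃ O, x ∈ O ∧ P i O) : ∃ O, x ∈ O ∧ ∀ i, P i O := by
  have key : ∃ O, x ∈ O ∧ ∀ i ∈ S, P i O := by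
    clear h
    induction S, hS using Set.Finite.induction_on with
    | empty => exact ⟨⊤, trivial, by simp⟩
    | @insert i T _ _ ih =>
      obtain ⟨O, hO, ih⟩ := ih
      obtain ⟨O', hO', hi⟩ := hx i
      refine ⟨O ⊓ O', ⟨hO, hO'⟩, ?_⟩
      rintro j (rfl | hj)
      · exact hP _ _ _ inf_le_right hi
      · exact hP _ _ _ inf_le_left (ih j hj)
  obtain ⟨O, hO, h'⟩ := key
  exact ⟨O, hO, fun i ↦ by_cases (fun hi : i ∈ S ↦ h' i hi) fun hi ↦ hP _ _ _ le_top (h i hi)⟩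

namespace HasDualBasis

variable {L : X.Modules} (hL : HasDualBasis L) {M : X.Modules} {x : X}

include hL

/-- A linear map between stalks extends to a neighbourhood if its source has a finite dual basis. -/
lemma exists_stalkFunctor_map_eq
    (φ : (stalkFunctor x).obj L ⟶ (stalkFunctor x).obj M) :
    ∃ (O : X.Opens) (hx : x ∈ O) (ψ : (Loc.ofModules O).obj L ⟶ (Loc.ofModules O).obj M),
      (Loc.stalkFunctor hx).map ψ = φ := by
  obtain ⟨n, e, p, h⟩ := hL.exists_sections
  obtain ⟨O, hx, hO⟩ := exists_forall_of_finite (x := x)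
    (fun (i : Fin n) O ↦ ∀ hx : x ∈ O, ∃ m : Γ(M, O), germ M O x hx m = φ (germ L ⊤ x trivial (e i)))
    (fun i O O' hO h hx ↦ by
      obtain ⟨m, hm⟩ := h (hO hx)
      exact ⟨M.presheaf.map (homOfLE hO).op m, (germ_res M hO hx m).trans hm⟩)
    Set.finite_univ (fun i hi ↦ (hi trivial).elim) fun i ↦ by
      obtain ⟨O, hx, m, hm⟩ := exists_germ_eq M (φ (germ L ⊤ x trivial (e i)))
      exact ⟨O, hx, fun _ ↦ ⟨m, hm⟩⟩
  choose m hm using fun i ↦ hO i hx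
  -- The extension is `l ↦ ∑ p_i(l) m_i` with `m_i` a section of germ `φ(e_i)`. Relations among the
  -- `e_i` need no check, since the formula makes sense for any `m_i`.
  refine ⟨O, hx, ∑ i, (Loc.ofModules O).map (p i) ≫ Loc.ofSection (m i),
    ModuleCat.hom_ext (LinearMap.ext (congrFun (Loc.stalk_hom_ext hx fun U hU hxU l ↦
      (Loc.stalkMap_germ hx _ U hU hxU l).trans ?_)))⟩
  let G : Γ(L, U) →+ M.stalk x := φ.hom.toAddMonoidHom.comp (germ L U x hxU).hom
  have h₁ : G l = ∑ i, G (formApp (p i) U l • L.presheaf.map (homOfLE le_top).op (e i)) :=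
    (congrArg G (h U l)).trans (map_sum G _ _)
  refine Eq.trans ?_ h₁.symm
  rw [Loc.app_sum]
  refine (map_sum (germ M U x hxU).hom _ _).trans (Finset.sum_congr rfl fun i _ ↦ ?_)
  refine (germ_smul M U x hxU (formApp (p i) U l) _).trans ?_
  rw [germ_res, hm]
  refine Eq.trans ?_ (congrArg φ (germ_smul L U x hxU (formApp (p i) U l) _)).symm
  rw [germ_res]
  exact (_root_.map_smul φ.hom _ _).symm

/-- A morphism over a neighbourhood of `x` inducing zero on the stalk at `x` is zero near `x` if its
source has a finite dual basis. -/
lemma exists_app_eq_zero {O : X.Opens} (hx : x ∈ O)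
    (φ : (Loc.ofModules O).obj L ⟶ (Loc.ofModules O).obj M) (hφ : (Loc.stalkFunctor hx).map φ = 0) :
    ∃ (O' : X.Opens) (h : O' ≤ O), x ∈ O' ∧ ∀ U (hU : U ≤ O'), Loc.app φ U (hU.trans h) = 0 := by
  obtain ⟨n, e, p, h⟩ := hL.exists_sections
  -- As `φ(l) = ∑ p_i(l) φ(e_i)`, it suffices that the finitely many sections `φ(e_i)`, whose germs
  -- at `x` vanish, are zero on a neighbourhood.
  let m (i : Fin n) : Γ(M, O) := Loc.app φ O le_rfl (L.presheaf.map (homOfLE le_top).op (e i))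
  obtain ⟨O', hx', hO'⟩ := exists_forall_of_finite (x := x)
    (fun (i : Fin n) O' ↦ ∀ U (hU : U ≤ O), U ≤ O' → M.presheaf.map (homOfLE hU).op (m i) = 0)
    (fun i O₁ O₂ hO h U hU hU' ↦ h U hU (hU'.trans hO))
    Set.finite_univ (fun i hi ↦ (hi trivial).elim) fun i ↦ by
      have : germ M O x hx (m i) = germ M O x hx 0 := by
        rw [map_zero]
        refine (Loc.stalkMap_germ hx φ O le_rfl hx _).symm.trans ?_
        exact congr($hφ _)
      obtain ⟨W, hW, h₁, h₂, e⟩ := exists_res_eq_of_germ_eq M hx hx _ _ this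
      refine ⟨W, hW, fun U hU hU' ↦ ?_⟩
      have h₃ := congrArg (M.presheaf.map (homOfLE hU').op) e
      rw [map_zero, map_zero] at h₃
      exact (congr($(M.presheaf.map_comp (homOfLE h₁).op (homOfLE hU').op) (m i))).trans h₃
  refine ⟨O' ⊓ O, inf_le_right, ⟨hx', hx⟩, fun U hU ↦ AddMonoidHom.ext fun l ↦ ?_⟩
  have hUO : U ≤ O := hU.trans inf_le_right
  let G : Γ(L, U) →+ Γ(M, U) := Loc.app φ U hUO
  refine (congrArg G (h U l)).trans ((map_sum G _ _).trans ?_)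
  refine Finset.sum_eq_zero fun i _ ↦ (φ.2.1 U hUO _ _).trans ?_
  have h₁ : Loc.app φ U hUO (L.presheaf.map (homOfLE le_top).op (e i)) = 0 := by
    refine Eq.trans ?_ (hO' i U hUO (hU.trans inf_le_left))
    refine Eq.trans (congrArg (Loc.app φ U hUO) ?_) (φ.2.2 O le_rfl U hUO _)
    exact congr($(L.presheaf.map_comp (homOfLE le_top).op (homOfLE hUO).op) (e i))
  exact (congrArg (_ • ·) h₁).trans (smul_zero (A := Γ(M, U)) _)

end HasDualBasis

end AlgebraicGeometry.Scheme.Modules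

end

/-! ### Extending cochains from a stalk to a neighbourhood. -/

noncomputable section

namespace AlgebraicGeometry.Scheme.Modules

open CochainComplex HomComplex

variable {X : Scheme.{u}}

namespace Loc

/-- The restriction to an open subset of a complex of sheaves of modules. -/
abbrev complex (O : X.Opens) : CochainComplex X.Modules ℤ ⥤ CochainComplex (Loc O) ℤ :=
  (ofModules O).mapHomologicalComplex _

variable {O : X.Opens} {K G H : CochainComplex X.Modules ℤ} {x : X} (hx : x ∈ O)

/-- The map induced on stalks by a cochain over a neighbourhood. -/
def stalkCochain {n : ℤ} : Cochain ((complex O).obj K) ((complex O).obj G) n →+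
    Cochain ((stalkComplex x).obj K) ((stalkComplex x).obj G) n where
  toFun z := Cochain.mk fun p q hpq ↦ (stalkFunctor hx).map (z.v p q hpq)
  map_zero' := by
    ext p q hpq : 1
    exact (stalkFunctor hx).map_zero _ _
  map_add' z z' := by
    ext p q hpq : 1
    exact (stalkFunctor hx).map_add

lemma stalkCochain_v {n : ℤ} (z : Cochain ((complex O).obj K) ((complex O).obj G) n) (p q : ℤ)
    (hpq : p + n = q) :
    (stalkCochain hx z).v p q hpq = (stalkFunctor hx).map (z.v p q hpq) :=
  rfl

lemma stalkCochain_δ {n : ℤ} (m : ℤ) (z : Cochain ((complex O).obj K) ((complex O).obj G) n) :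
    stalkCochain hx (δ n m z) = δ n m (stalkCochain hx z) := by
  by_cases hnm : n + 1 = m
  · ext p q hpq : 1
    rw [stalkCochain_v, δ_v n m hnm _ p q hpq (q - 1) (p + 1) rfl rfl,
      δ_v n m hnm _ p q hpq (q - 1) (p + 1) rfl rfl, Functor.map_add, Functor.map_units_smul,
      Functor.map_comp, Functor.map_comp, stalkCochain_v, stalkCochain_v]
    exact congrArg₂ (· + ·) (congrArg ((stalkFunctor hx).map (z.v p (q - 1) (by lia)) ≫ ·)
      (stalkFunctor_map_ofModules_map hx (G.d (q - 1) q)))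
      (congrArg (m.negOnePow • ·) (congrArg (· ≫ (stalkFunctor hx).map (z.v (p + 1) q (by lia)))
        (stalkFunctor_map_ofModules_map hx (K.d p (p + 1)))))
  · rw [δ_shape _ _ hnm, δ_shape _ _ hnm, map_zero]

lemma stalkCochain_comp (z : Cochain ((complex O).obj K) ((complex O).obj G) 0)
    (z' : Cochain ((complex O).obj G) ((complex O).obj H) 0) :
    stalkCochain hx (z.comp z' (add_zero 0)) =
      (stalkCochain hx z).comp (stalkCochain hx z') (add_zero 0) := by
  ext p : 1
  rw [stalkCochain_v, Cochain.comp_zero_cochain_v, Cochain.comp_zero_cochain_v, Functor.map_comp]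
  rfl

lemma stalkCochain_ofHom (f : K ⟶ G) :
    stalkCochain hx (Cochain.ofHom ((complex O).map f)) =
      Cochain.ofHom ((stalkComplex x).map f) := by
  ext p : 1
  rw [stalkCochain_v, Cochain.ofHom_v, Cochain.ofHom_v]
  exact stalkFunctor_map_ofModules_map hx _

end Loc

variable {K G : CochainComplex X.Modules ℤ} (hK : IsBoundedDual K) {x : X}

include hK

lemma IsBoundedDual.exists_finite_triplet (n : ℤ) :
    ∃ S : Set (Triplet n), S.Finite ∧ ∀ t ∉ S, Limits.IsZero (K.X t.p) := by
  obtain ⟨⟨a, b, _, _⟩, -⟩ := hK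
  exact ⟨_, finite_triplet n a b, fun t ht ↦ isZero_of_isStrictly K a b t.p ht⟩

/-- A cochain need not commute with differentials, so its finitely many nonzero components extend
independently. All smaller `O'` are allowed so that several cochains can be extended over one
neighbourhood. -/
theorem IsBoundedDual.exists_stalkCochain_eq {n : ℤ}
    (z : Cochain ((stalkComplex x).obj K) ((stalkComplex x).obj G) n) :
    ∃ O : X.Opens, x ∈ O ∧ ∀ O' ≤ O, ∀ hx : x ∈ O',
      ∃ z' : Cochain ((Loc.complex O').obj K) ((Loc.complex O').obj G) n,
        Loc.stalkCochain hx z' = z := by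
  obtain ⟨S, hS, hS0⟩ := hK.exists_finite_triplet n
  obtain ⟨O, hxO, hO⟩ := exists_forall_of_finite (x := x)
    (fun (t : Triplet n) O ↦ ∀ hx : x ∈ O,
      ∃ ψ : (Loc.ofModules O).obj (K.X t.p) ⟶ (Loc.ofModules O).obj (G.X t.q),
        (Loc.stalkFunctor hx).map ψ = z.v t.p t.q t.hpq)
    (fun t O O' hO h hx ↦ by
      obtain ⟨ψ, hψ⟩ := h (hO hx)
      exact ⟨Loc.res hO ψ, (Loc.stalkFunctor_map_res _ hO hx ψ).trans hψ⟩) hS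
    (fun t ht hx ↦ ⟨0, ((stalkFunctor x).map_isZero (hS0 t ht)).eq_of_src _ _⟩)
    fun t ↦ by
      obtain ⟨O, hx, ψ, hψ⟩ := (hK.2 t.p).exists_stalkFunctor_map_eq (z.v t.p t.q t.hpq)
      exact ⟨O, hx, fun _ ↦ ⟨ψ, hψ⟩⟩
  refine ⟨O, hxO, fun O' h hx ↦ ?_⟩
  choose ψ hψ using fun t ↦ hO t hxO
  refine ⟨Cochain.mk fun p q hpq ↦ Loc.res h (ψ ⟨p, q, hpq⟩), ?_⟩
  ext p q hpq : 1
  rw [Loc.stalkCochain_v]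
  exact (Loc.stalkFunctor_map_res hxO h hx _).trans (hψ _)

theorem IsBoundedDual.exists_app_eq_zero {n : ℤ} {O : X.Opens} (hx : x ∈ O)
    (z : Cochain ((Loc.complex O).obj K) ((Loc.complex O).obj G) n)
    (hz : Loc.stalkCochain hx z = 0) :
    ∃ (O' : X.Opens) (h : O' ≤ O), x ∈ O' ∧ ∀ p q hpq U (hU : U ≤ O'),
      Loc.app (z.v p q hpq) U (hU.trans h) = 0 := by
  obtain ⟨S, hS, hS0⟩ := hK.exists_finite_triplet n
  obtain ⟨O', hxO', hO'⟩ := exists_forall_of_finite (x := x)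
    (fun (t : Triplet n) O' ↦ ∀ U (hU : U ≤ O), U ≤ O' →
      Loc.app (z.v t.p t.q t.hpq) U hU = 0)
    (fun t O₁ O₂ hO h U hU hU' ↦ h U hU (hU'.trans hO)) hS
    (fun t ht U hU _ ↦ by
      rw [((Loc.ofModules O).map_isZero (hS0 t ht)).eq_of_src (z.v t.p t.q t.hpq) 0]
      rfl)
    fun t ↦ by
      obtain ⟨O', h, hx', hO'⟩ := (hK.2 t.p).exists_app_eq_zero hx (z.v t.p t.q t.hpq)
        (congr(Cochain.v $hz t.p t.q t.hpq))
      exact ⟨O', hx', fun U hU hU' ↦ hO' U hU'⟩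
  exact ⟨O' ⊓ O, inf_le_right, ⟨hxO', hx⟩, fun p q hpq U hU ↦
    hO' ⟨p, q, hpq⟩ U (hU.trans inf_le_right) (hU.trans inf_le_left)⟩

theorem IsBoundedDual.exists_stalkCochain_eq_zero {n : ℤ} {O : X.Opens} (hx : x ∈ O)
    (z : Cochain ((Loc.complex O).obj K) ((Loc.complex O).obj G) n)
    (hz : Loc.stalkCochain hx z = 0) :
    ∃ O' : X.Opens, x ∈ O' ∧ ∀ y (hy : y ∈ O), y ∈ O' → Loc.stalkCochain hy z = 0 := by
  obtain ⟨O', h, hx', hO'⟩ := hK.exists_app_eq_zero hx z hz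
  refine ⟨O', hx', fun y hy hy' ↦ ?_⟩
  ext p q hpq : 1
  exact Loc.stalkFunctor_map_eq_zero hy h hy' _ (hO' p q hpq)

end AlgebraicGeometry.Scheme.Modules

section Homotopies

open CochainComplex HomComplex


theorem CochainComplex.HomComplex.Cochain.exists_eq_ofHom {C : Type*} [Category* C]
    [Preadditive C] {K L : CochainComplex C ℤ}
    (z : Cochain K L 0) (hz : δ 0 1 z = 0) : ∃ f : K ⟶ L, Cochain.ofHom f = z :=
  ⟨Cocycle.homOf (Cocycle.mk z 1 (zero_add 1) hz), Cocycle.cochain_ofHom_homOf_eq_coe _⟩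

/-- If `b ≫ s` is homotopic to `a` for a homotopy equivalence `b`, all this expressed by cochains,
and `s` is a quasi-isomorphism, then so is `a`. -/
theorem CochainComplex.quasiIso_of_cochains {C : Type*} [Category* C] [Abelian C] {L M : CochainComplex C ℤ}
    (a s : L ⟶ M)
    [QuasiIso s] (b c : Cochain L L 0) (h₁ : Cochain L M (-1)) (h₂ h₃ : Cochain L L (-1))
    (hb : δ 0 1 b = 0) (hc : δ 0 1 c = 0)
    (e₁ : b.comp (Cochain.ofHom s) (add_zero 0) - (δ (-1) 0 h₁ + Cochain.ofHom a) = 0)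
    (e₂ : b.comp c (add_zero 0) - (δ (-1) 0 h₂ + Cochain.ofHom (𝟙 L)) = 0)
    (e₃ : c.comp b (add_zero 0) - (δ (-1) 0 h₃ + Cochain.ofHom (𝟙 L)) = 0) : QuasiIso a := by
  obtain ⟨b, rfl⟩ := b.exists_eq_ofHom hb
  obtain ⟨c, rfl⟩ := c.exists_eq_ofHom hc
  rw [sub_eq_zero, ← Cochain.ofHom_comp] at e₁ e₂ e₃
  let E : HomotopyEquiv L L :=
    { hom := b
      inv := c
      homotopyHomInvId := (Cochain.equivHomotopy _ _).symm ⟨h₂, e₂⟩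
      homotopyInvHomId := (Cochain.equivHomotopy _ _).symm ⟨h₃, e₃⟩ }
  have : QuasiIso b := E.quasiIso_hom
  exact QuasiIso.of_homotopy ((Cochain.equivHomotopy _ _).symm ⟨h₁, e₁⟩).symm

end Homotopies

end

/-! ### Openness of the quasi-isomorphism locus. -/

noncomputable section

open CochainComplex HomComplex

/-- Two quasi-isomorphisms out of a K-projective complex differ by a homotopy equivalence. -/
theorem CochainComplex.IsKProjective.exists_cochains {C : Type u} [Category.{v} C] [Abelian C]
    {L M : CochainComplex C ℤ} [L.IsKProjective] (a s : L ⟶ M) [QuasiIso a] [QuasiIso s] :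
    ∃ (b c : L ⟶ L) (h₁ : Cochain L M (-1)) (h₂ h₃ : Cochain L L (-1)),
      (Cochain.ofHom b).comp (Cochain.ofHom s) (add_zero 0) -
        (δ (-1) 0 h₁ + Cochain.ofHom a) = 0 ∧
      (Cochain.ofHom b).comp (Cochain.ofHom c) (add_zero 0) -
        (δ (-1) 0 h₂ + Cochain.ofHom (𝟙 L)) = 0 ∧
      (Cochain.ofHom c).comp (Cochain.ofHom b) (add_zero 0) -
        (δ (-1) 0 h₃ + Cochain.ofHom (𝟙 L)) = 0 := by
  obtain ⟨b, ⟨hb⟩⟩ := exists_lift s a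
  obtain ⟨c, ⟨hc⟩⟩ := exists_lift a s
  obtain ⟨h₂⟩ : Nonempty (Homotopy (b ≫ c) (𝟙 L)) := homotopy_of_comp a
    ((Homotopy.ofEq (Category.assoc b c a)).trans ((hc.compLeft b).trans
      (hb.trans (Homotopy.ofEq (Category.id_comp a).symm))))
  obtain ⟨h₃⟩ : Nonempty (Homotopy (c ≫ b) (𝟙 L)) := homotopy_of_comp s
    ((Homotopy.ofEq (Category.assoc c b s)).trans ((hb.compLeft c).trans
      (hc.trans (Homotopy.ofEq (Category.id_comp s).symm))))
  obtain ⟨k₁, e₁⟩ := Cochain.equivHomotopy _ _ hb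
  obtain ⟨k₂, e₂⟩ := Cochain.equivHomotopy _ _ h₂
  obtain ⟨k₃, e₃⟩ := Cochain.equivHomotopy _ _ h₃
  -- The relations are phrased as the vanishing of a cochain, the kind of condition that spreads
  -- from a stalk to a neighbourhood.
  simp only [← Cochain.ofHom_comp, sub_eq_zero]
  exact ⟨b, c, k₁, k₂, k₃, e₁, e₂, e₃⟩

namespace AlgebraicGeometry.Scheme.Modules

variable {X : Scheme.{u}}

lemma Loc.stalkCochain_comp_sub {O : X.Opens} {x : X} (hx : x ∈ O)
    {K G H : CochainComplex X.Modules ℤ} (z : Cochain ((complex O).obj K) ((complex O).obj G) 0)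
    (z' : Cochain ((complex O).obj G) ((complex O).obj H) 0)
    (η : Cochain ((complex O).obj K) ((complex O).obj H) (-1)) (g : K ⟶ H) :
    stalkCochain hx (z.comp z' (add_zero 0) - (δ (-1) 0 η + Cochain.ofHom ((complex O).map g))) =
      (stalkCochain hx z).comp (stalkCochain hx z') (add_zero 0) -
        (δ (-1) 0 (stalkCochain hx η) + Cochain.ofHom ((stalkComplex x).map g)) := by
  rw [map_sub, map_add, stalkCochain_comp, stalkCochain_δ, stalkCochain_ofHom]

/-- A morphism from a bounded complex with finite dual bases is a quasi-isomorphism near any point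
where it is one, if the source and the target are quasi-isomorphic. -/
theorem IsBoundedDual.exists_forall_quasiIso {L M : CochainComplex X.Modules ℤ}
    (hL : IsBoundedDual L) (a s : L ⟶ M) [QuasiIso s] (x : X)
    (ha : QuasiIso ((stalkComplex x).map a)) :
    ∃ O : X.Opens, x ∈ O ∧ ∀ y ∈ O, QuasiIso ((stalkComplex y).map a) := by
  have hs := (quasiIso_iff_stalkComplex_map s).mp inferInstance
  have := (hL.isStrictlyPerfect x).isKProjective
  have := hs x
  -- The stalk of `L` at `x` is K-projective, so there the two quasi-isomorphisms differ by a
  -- homotopy equivalence: five cochains subject to five equations, counting the two cocycle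
  -- conditions.
  obtain ⟨b, c, h₁, h₂, h₃, e₁, e₂, e₃⟩ :=
    IsKProjective.exists_cochains ((stalkComplex x).map a) ((stalkComplex x).map s)
  obtain ⟨O₁, hx₁, hO₁⟩ := hL.exists_stalkCochain_eq (Cochain.ofHom b)
  obtain ⟨O₂, hx₂, hO₂⟩ := hL.exists_stalkCochain_eq (Cochain.ofHom c)
  obtain ⟨O₃, hx₃, hO₃⟩ := hL.exists_stalkCochain_eq h₁
  obtain ⟨O₄, hx₄, hO₄⟩ := hL.exists_stalkCochain_eq h₂
  obtain ⟨O₅, hx₅, hO₅⟩ := hL.exists_stalkCochain_eq h₃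
  have hx : x ∈ O₁ ⊓ O₂ ⊓ O₃ ⊓ O₄ ⊓ O₅ := ⟨⟨⟨⟨hx₁, hx₂⟩, hx₃⟩, hx₄⟩, hx₅⟩
  generalize hO : O₁ ⊓ O₂ ⊓ O₃ ⊓ O₄ ⊓ O₅ = O at hx
  obtain ⟨β, hβ⟩ := hO₁ O (by simp [← hO, inf_assoc]) hx
  obtain ⟨γ, hγ⟩ := hO₂ O (by rw [← hO]; exact fun _ h ↦ h.1.1.1.2) hx
  obtain ⟨η₁, hη₁⟩ := hO₃ O (by rw [← hO]; exact fun _ h ↦ h.1.1.2) hx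
  obtain ⟨η₂, hη₂⟩ := hO₄ O (by rw [← hO]; exact fun _ h ↦ h.1.2) hx
  obtain ⟨η₃, hη₃⟩ := hO₅ O (by rw [← hO]; exact fun _ h ↦ h.2) hx
  -- The extended cochains satisfy the equations only at `x`; the defect of each equation has zero
  -- stalk at `x`, hence at all nearby points.
  obtain ⟨V₁, hV₁, hz₁⟩ := hL.exists_stalkCochain_eq_zero hx (δ 0 1 β) (by
    rw [Loc.stalkCochain_δ, hβ, δ_ofHom])
  obtain ⟨V₂, hV₂, hz₂⟩ := hL.exists_stalkCochain_eq_zero hx (δ 0 1 γ) (by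
    rw [Loc.stalkCochain_δ, hγ, δ_ofHom])
  obtain ⟨V₃, hV₃, hz₃⟩ := hL.exists_stalkCochain_eq_zero hx
    (β.comp (Cochain.ofHom ((Loc.complex O).map s)) (add_zero 0) -
      (δ (-1) 0 η₁ + Cochain.ofHom ((Loc.complex O).map a))) (by
    rw [Loc.stalkCochain_comp_sub, hβ, hη₁, Loc.stalkCochain_ofHom, e₁])
  obtain ⟨V₄, hV₄, hz₄⟩ := hL.exists_stalkCochain_eq_zero hx
    (β.comp γ (add_zero 0) - (δ (-1) 0 η₂ + Cochain.ofHom ((Loc.complex O).map (𝟙 L)))) (by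
    rw [Loc.stalkCochain_comp_sub, hβ, hη₂, hγ, CategoryTheory.Functor.map_id, e₂])
  obtain ⟨V₅, hV₅, hz₅⟩ := hL.exists_stalkCochain_eq_zero hx
    (γ.comp β (add_zero 0) - (δ (-1) 0 η₃ + Cochain.ofHom ((Loc.complex O).map (𝟙 L)))) (by
    rw [Loc.stalkCochain_comp_sub, hβ, hη₃, hγ, CategoryTheory.Functor.map_id, e₃])
  refine ⟨O ⊓ V₁ ⊓ V₂ ⊓ V₃ ⊓ V₄ ⊓ V₅, ⟨⟨⟨⟨⟨hx, hV₁⟩, hV₂⟩, hV₃⟩, hV₄⟩, hV₅⟩, ?_⟩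
  rintro y ⟨⟨⟨⟨⟨hy, hy₁⟩, hy₂⟩, hy₃⟩, hy₄⟩, hy₅⟩
  have := hs y
  have E₁ := hz₁ y hy hy₁
  have E₂ := hz₂ y hy hy₂
  have E₃ := hz₃ y hy hy₃
  have E₄ := hz₄ y hy hy₄
  have E₅ := hz₅ y hy hy₅
  rw [Loc.stalkCochain_δ] at E₁ E₂
  rw [Loc.stalkCochain_comp_sub] at E₃ E₄ E₅
  rw [Loc.stalkCochain_ofHom] at E₃
  rw [CategoryTheory.Functor.map_id] at E₄ E₅
  exact quasiIso_of_cochains _ ((stalkComplex y).map s) _ _ _ _ _ E₁ E₂ E₃ E₄ E₅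

end AlgebraicGeometry.Scheme.Modules

end

/-! ### Descent along flat open morphisms, and morphisms on open subschemes. -/

noncomputable section

namespace AlgebraicGeometry.Scheme.Modules

open CochainComplex HomComplex

variable {X Y : Scheme.{u}}

/-- Let `f` be flat and open and let `K` be bounded with finite dual bases. If the pullbacks of `K`
and `G` are quasi-isomorphic, then any morphism from `K` to `G` that is a quasi-isomorphism at the
image of a point is one near this image. -/
theorem IsBoundedDual.exists_forall_quasiIso_of_flat {K G : CochainComplex X.Modules ℤ}
    (hK : IsBoundedDual K) (g : K ⟶ G) (f : Y ⟶ X) [Flat f] (hf : IsOpenMap f) (y : Y)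
    (hg : QuasiIso ((stalkComplex (f y)).map g))
    (h : QuasiIsomorphic (pullbackComplex f K) (pullbackComplex f G)) :
    ∃ O : X.Opens, f y ∈ O ∧ ∀ x ∈ O, QuasiIso ((stalkComplex x).map g) := by
  -- No quasi-isomorphism from `K` to `G` is available to compare with `g`. The roof supplies one
  -- from the pullback of `K` to `M`, to be compared with the pullback of `g` followed by `t`.
  obtain ⟨M, s, t, _, ht⟩ : ∃ (M : CochainComplex Y.Modules ℤ) (s : (pullbackFunctor f).obj K ⟶ M)
    (t : (pullbackFunctor f).obj G ⟶ M), QuasiIso s ∧ QuasiIso t := h.exists_roof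
  rw [quasiIso_iff_stalkComplex_map] at ht
  have ha : QuasiIso ((stalkComplex y).map ((pullbackFunctor f).map g ≫ t)) := by
    have := (quasiIso_stalkComplex_map_pullbackFunctor_map_iff_of_flat f y g).mpr hg
    have := ht y
    rw [Functor.map_comp]
    infer_instance
  obtain ⟨O, hy, hO⟩ := IsBoundedDual.exists_forall_quasiIso (L := (pullbackFunctor f).obj K)
    (hK.pullback f) _ s y ha
  refine ⟨⟨f '' O, hf _ O.isOpen⟩, ⟨y, hy, rfl⟩, ?_⟩
  rintro _ ⟨z, hz, rfl⟩
  have h1 := hO z hz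
  have := ht z
  rw [Functor.map_comp] at h1
  exact (quasiIso_stalkComplex_map_pullbackFunctor_map_iff_of_flat f z g).mp
    (quasiIso_of_comp_right _ ((stalkComplex z).map t))

lemma restrict_smul (j : Y ⟶ X) [IsOpenImmersion j] (M : X.Modules) (U : Y.Opens) (r : Γ(Y, U))
    (m : Γ((restrictFunctor j).obj M, U)) :
    r • m = (show Γ(M, j ''ᵁ U) from (j.appIso U).inv r • (show Γ(M, j ''ᵁ U) from m)) :=
  congr($(smul_restrictAppIso_hom j M U r) m)

namespace Loc

section

variable {V : X.Opens}

lemma image_ι_le (U : (V : Scheme.{u}).Opens) : V.ι ''ᵁ U ≤ V := by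
  simpa using V.ι.image_le_opensRange U

lemma app_restrict_smul {L M : Loc V} (φ : L ⟶ M) (U : (V : Scheme.{u}).Opens) (r : Γ(V, U))
    (l : Γ((restrictFunctor V.ι).obj L.sheaf, U)) :
    (show Γ((restrictFunctor V.ι).obj M.sheaf, U) from
      app φ (V.ι ''ᵁ U) (image_ι_le U) (r • l)) =
      r • (show Γ((restrictFunctor V.ι).obj M.sheaf, U) from
        app φ (V.ι ''ᵁ U) (image_ι_le U) l) :=
  (congrArg (app φ (V.ι ''ᵁ U) (image_ι_le U)) (restrict_smul V.ι L.sheaf U r l)).trans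
    ((φ.2.1 (V.ι ''ᵁ U) (image_ι_le U) ((V.ι.appIso U).inv r) l).trans
      (restrict_smul V.ι M.sheaf U r _).symm)

/-- The action of a morphism over an open subset on the sections over the open subscheme. -/
def toRestrictApp {L M : Loc V} (φ : L ⟶ M) (U : (V : Scheme.{u}).Opens) :
    Γ((restrictFunctor V.ι).obj L.sheaf, U) →+ Γ((restrictFunctor V.ι).obj M.sheaf, U) :=
  (M.sheaf.restrictAppIso V.ι U).inv.hom.comp
    ((app φ (V.ι ''ᵁ U) (image_ι_le U)).comp (L.sheaf.restrictAppIso V.ι U).hom.hom)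

lemma toRestrictApp_res {L M : Loc V} (φ : L ⟶ M) (U U' : (V : Scheme.{u}).Opens) (hU : U' ≤ U)
    (m : Γ((restrictFunctor V.ι).obj L.sheaf, U)) :
    toRestrictApp φ U' (((restrictFunctor V.ι).obj L.sheaf).presheaf.map (homOfLE hU).op m) =
      ((restrictFunctor V.ι).obj M.sheaf).presheaf.map (homOfLE hU).op (toRestrictApp φ U m) := by
  have h := φ.2.2 (V.ι ''ᵁ U) (image_ι_le U) (V.ι ''ᵁ U') (V.ι.image_mono hU)
    ((L.sheaf.restrictAppIso V.ι U).hom m)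
  exact h

/-- The morphism of sheaves on the open subscheme given by a morphism over the open subset. -/
def toRestrictMap {L M : Loc V} (φ : L ⟶ M) :
    (restrictFunctor V.ι).obj L.sheaf ⟶ (restrictFunctor V.ι).obj M.sheaf :=
  homMk (toRestrictApp φ) (app_restrict_smul φ) (toRestrictApp_res φ)

/-- Sheaves over an open subset as sheaves on the corresponding open subscheme. -/
def toRestrict (V : X.Opens) : Loc V ⥤ (V : Scheme.{u}).Modules where
  obj L := (restrictFunctor V.ι).obj L.sheaf
  map φ := toRestrictMap φ
  map_id _ := rfl
  map_comp _ _ := rfl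

instance : (toRestrict V).Additive where
  map_add := rfl

/-- Restriction to an open subset is pullback to the open subscheme. -/
def ofModulesToRestrictIso (V : X.Opens) : ofModules V ⋙ toRestrict V ≅ pullback V.ι :=
  NatIso.ofComponents (fun L ↦ (restrictFunctorIsoPullback V.ι).app L)
    (fun f ↦ (restrictFunctorIsoPullback V.ι).hom.naturality f)

lemma restrictStalkNatIso_hom_germ (M : X.Modules) (v : (V : Scheme.{u})) (U : (V : Scheme.{u}).Opens)
    (hv : v ∈ U) (m : Γ((restrictFunctor V.ι).obj M, U)) :
    (restrictStalkNatIso V.ι v).hom.app M (germ ((restrictFunctor V.ι).obj M) U v hv m) =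
      germ M (V.ι ''ᵁ U) (V.ι v) ⟨v, hv, rfl⟩ m :=
  congr($(germ_restrictStalkNatIso_hom_app V.ι v M hv) m)

/-- The stalks of the restriction to an open subscheme. -/
def toRestrictStalkIso (v : (V : Scheme.{u})) (hv : V.ι v ∈ V) :
    toRestrict V ⋙ Modules.stalkFunctor v ⋙ forget₂ (ModuleCat _) Ab.{u} ≅
      stalkFunctor hv ⋙ forget₂ (ModuleCat _) Ab.{u} :=
  NatIso.ofComponents (fun L ↦ (restrictStalkNatIso V.ι v).app L.sheaf) (fun {L M} φ ↦ by
    ext m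
    obtain ⟨U, hU, m, rfl⟩ := exists_germ_eq ((toRestrict V).obj L) m
    refine (congrArg ((restrictStalkNatIso V.ι v).hom.app M.sheaf)
      (Modules.stalkMap_germ ((toRestrict V).map φ) U v hU m)).trans ?_
    refine (restrictStalkNatIso_hom_germ M.sheaf v U hU _).trans ?_
    refine Eq.trans ?_ (congrArg (stalkMap hv φ)
      (restrictStalkNatIso_hom_germ L.sheaf v U hU m)).symm
    exact (stalkMap_germ hv φ _ _ _ m).symm)

/-- The stalk of a sheaf can be computed after restriction to a neighbourhood. -/
def ofModulesStalkIso {x : X} (hx : x ∈ V) :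
    ofModules V ⋙ stalkFunctor hx ≅ Modules.stalkFunctor x :=
  NatIso.ofComponents (fun _ ↦ Iso.refl _) fun f ↦
    (Category.comp_id _).trans
      ((stalkFunctor_map_ofModules_map hx f).trans (Category.id_comp _).symm)

end

variable {O V : X.Opens} (h : V ≤ O) {K G : CochainComplex X.Modules ℤ}

/-- The restriction of a cochain to a smaller open subset. -/
def resCochain {n : ℤ} (z : Cochain ((complex O).obj K) ((complex O).obj G) n) :
    Cochain ((complex V).obj K) ((complex V).obj G) n :=
  Cochain.mk fun p q hpq ↦ res h (z.v p q hpq)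

lemma stalkCochain_resCochain {n : ℤ} (z : Cochain ((complex O).obj K) ((complex O).obj G) n)
    {x : X} (hx : x ∈ V) : stalkCochain hx (resCochain h z) = stalkCochain (h hx) z := by
  ext p q hpq : 1
  exact stalkFunctor_map_res (h hx) h hx _

/-- Turns a cochain whose `δ` vanishes on the open subsets of `V` into a cocycle over `V`. -/
lemma δ_resCochain_eq_zero {n m : ℤ} (z : Cochain ((complex O).obj K) ((complex O).obj G) n)
    (hz : ∀ p q hpq U (hU : U ≤ V), app ((δ n m z).v p q hpq) U (hU.trans h) = 0) :
    δ n m (resCochain h z) = 0 := by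
  by_cases hnm : n + 1 = m
  · ext p q hpq : 1
    refine hom_ext fun U hU ↦ Eq.trans ?_ (hz p q hpq U hU)
    rw [δ_v n m hnm _ p q hpq (q - 1) (p + 1) rfl rfl, δ_v n m hnm _ p q hpq (q - 1) (p + 1) rfl rfl]
    -- Once the sign is an explicit 1 or -1, restriction and `δ` commute definitionally.
    obtain h1 | h1 := Int.units_eq_one_or m.negOnePow
    · rw [h1, one_smul, one_smul]
      rfl
    · rw [h1, Units.neg_smul, Units.neg_smul, one_smul, one_smul]
      rfl
  · exact δ_shape _ _ hnm _

end Loc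

theorem Loc.exists_pullback_hom {V : X.Opens} {K G : CochainComplex X.Modules ℤ}
    (g : (complex V).obj K ⟶ (complex V).obj G) (v : (V : Scheme.{u})) (hv : V.ι v ∈ V)
    (hg : QuasiIso (((stalkFunctor hv).mapHomologicalComplex _).map g)) :
    ∃ g' : (pullbackFunctor V.ι).obj K ⟶ (pullbackFunctor V.ι).obj G,
      QuasiIso ((stalkComplex v).map g') := by
  have h : QuasiIso ((stalkComplex v).map (((toRestrict V).mapHomologicalComplex _).map g)) := by
    -- The two stalks are modules over different rings, the local rings of `V` at `v` and of `X` at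
    -- its image, so they are compared as abelian groups.
    rw [← HomologicalComplex.quasiIso_map_iff_of_preservesHomology
      (F := forget₂ (ModuleCat _) Ab.{u})] at hg ⊢
    exact (quasiIso_map_iff_of_natIso (toRestrictStalkIso v hv) g).mpr hg
  let e : (ofModules V ⋙ toRestrict V).mapHomologicalComplex (.up ℤ) ≅ pullbackFunctor V.ι :=
    NatIso.mapHomologicalComplex (ofModulesToRestrictIso V) (.up ℤ)
  obtain ⟨g', _⟩ : ∃ g' : ((ofModules V ⋙ toRestrict V).mapHomologicalComplex (.up ℤ)).obj K ⟶
      ((ofModules V ⋙ toRestrict V).mapHomologicalComplex (.up ℤ)).obj G,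
      QuasiIso ((stalkComplex v).map g') := ⟨_, h⟩
  refine ⟨e.inv.app K ≫ g' ≫ e.hom.app G, ?_⟩
  rw [Functor.map_comp, Functor.map_comp]
  infer_instance

/-- As a cochain of degree 0, `φ` extends to a neighbourhood. Its `δ` has zero stalk at `x`, so it
vanishes on a smaller neighbourhood `V`, over which the cochain is a morphism of complexes. -/
theorem IsBoundedDual.exists_pullback_hom {K G : CochainComplex X.Modules ℤ}
    (hK : IsBoundedDual K) {x : X} (φ : (stalkComplex x).obj K ⟶ (stalkComplex x).obj G)
    [QuasiIso φ] :
    ∃ (V : X.Opens) (v : (V : Scheme.{u})) (_ : V.ι v = x)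
      (g : (pullbackFunctor V.ι).obj K ⟶ (pullbackFunctor V.ι).obj G),
      QuasiIso ((stalkComplex v).map g) := by
  obtain ⟨O, hx, hO⟩ := hK.exists_stalkCochain_eq (Cochain.ofHom φ)
  obtain ⟨z, hz⟩ := hO O le_rfl hx
  obtain ⟨V, h, hxV, hV⟩ := hK.exists_app_eq_zero hx (δ 0 1 z) (by
    rw [Loc.stalkCochain_δ, hz, δ_ofHom])
  obtain ⟨g, hg⟩ := Cochain.exists_eq_ofHom (Loc.resCochain h z) (Loc.δ_resCochain_eq_zero h z hV)
  have hgφ (p : ℤ) : (Loc.stalkFunctor hxV).map (g.f p) = φ.f p := by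
    have h1 := Loc.stalkCochain_resCochain h z hxV
    rw [← hg, hz] at h1
    have h2 := congr(Cochain.v $h1 p p (add_zero p))
    rwa [Loc.stalkCochain_v, Cochain.ofHom_v, Cochain.ofHom_v] at h2
  obtain ⟨v, rfl⟩ : ∃ v : (V : Scheme.{u}), V.ι v = x := ⟨⟨x, hxV⟩, rfl⟩
  obtain ⟨g', hg'⟩ := Loc.exists_pullback_hom g v hxV
    ((quasiIso_iff_of_arrow_mk_iso _ φ (Arrow.isoMk
      ((NatIso.mapHomologicalComplex (Loc.ofModulesStalkIso hxV) _).app K)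
      ((NatIso.mapHomologicalComplex (Loc.ofModulesStalkIso hxV) _).app G) (by
        ext p : 1
        exact (Category.id_comp _).trans ((hgφ p).symm.trans (Category.comp_id _).symm)))).mpr
      inferInstance)
  exact ⟨V, v, rfl, g', hg'⟩

end AlgebraicGeometry.Scheme.Modules

end

/-! ### The scheme form. -/

noncomputable section

namespace AlgebraicGeometry.Scheme.Modules

variable {X Y Z : Scheme.{u}}

theorem quasiIsomorphic_pullbackComplex_comp_iff (f : Z ⟶ Y) (g : Y ⟶ X)
    (K L : CochainComplex X.Modules ℤ) :
    QuasiIsomorphic (pullbackComplex f (pullbackComplex g K))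
      (pullbackComplex f (pullbackComplex g L)) ↔
    QuasiIsomorphic (pullbackComplex (f ≫ g) K) (pullbackComplex (f ≫ g) L) :=
  ⟨fun h ↦ ((QuasiIsomorphic.of_iso (pullbackComplexComp f g K).symm).trans h).trans
    (.of_iso (pullbackComplexComp f g L)),
  fun h ↦ ((QuasiIsomorphic.of_iso (pullbackComplexComp f g K)).trans h).trans
    (.of_iso (pullbackComplexComp f g L).symm)⟩

/-- Let `K` be bounded with finite dual bases. If `K` and `G` become quasi-isomorphic after pullback
along a flat morphism `p` that is locally of finite presentation, then they are quasi-isomorphic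
near any point in the image of `p` with noetherian local ring and infinite residue field. -/
theorem IsBoundedDual.exists_quasiIsomorphic_pullbackComplex {K G : CochainComplex X.Modules ℤ}
    (hK : IsBoundedDual K) (p : Y ⟶ X) [Flat p] [LocallyOfFinitePresentation p] (y : Y)
    [IsNoetherianRing (X.presheaf.stalk (p y))] [Infinite (X.residueField (p y))]
    (h : QuasiIsomorphic (pullbackComplex p K) (pullbackComplex p G)) :
    ∃ (U : Scheme.{u}) (j : U ⟶ X), IsOpenImmersion j ∧ (∃ u, j u = p y) ∧
      QuasiIsomorphic (pullbackComplex j K) (pullbackComplex j G) := by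
  have : Infinite (IsLocalRing.ResidueField (X.presheaf.stalk (p y))) :=
    inferInstanceAs (Infinite (X.residueField (p y)))
  -- The local form for `𝒪_{X,p(y)} → 𝒪_{Y,y}`: the stalks at `y` of the pullbacks are base changes
  -- of the stalks at `p y`.
  obtain ⟨φ, _⟩ := exists_quasiIso_of_extendScalars _ (faithfullyFlat_stalkMap p y) _ _
    (hK.isStrictlyPerfect (p y)) (((QuasiIsomorphic.of_iso (pullbackComplexStalkIso p y K).symm).trans
      (h.stalkComplex y)).trans (.of_iso (pullbackComplexStalkIso p y G)))
  obtain ⟨V, v, hv, g, hg⟩ := hK.exists_pullback_hom φ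
  have hyV : y ∈ p ⁻¹ᵁ V := by
    change p y ∈ V
    rw [← hv]
    exact v.2
  let y' : (p ⁻¹ᵁ V : Scheme.{u}) := ⟨y, hyV⟩
  have hy' : (p ∣_ V) y' = v := by
    apply V.ι.isOpenEmbedding.injective
    rw [hv]
    exact congr($(morphismRestrict_ι p V) y')
  -- `g` lives on `V` only, so `p` is restricted over `V`; it stays flat and locally of finite
  -- presentation, hence open.
  obtain ⟨O, hO, hgO⟩ := IsBoundedDual.exists_forall_quasiIso_of_flat
    (K := (pullbackFunctor V.ι).obj K) (hK.pullback V.ι) g (p ∣_ V) (p ∣_ V).isOpenMap y'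
    (by rwa [hy']) (by
      refine (quasiIsomorphic_pullbackComplex_comp_iff _ _ K G).mpr ?_
      rw [morphismRestrict_ι]
      exact (quasiIsomorphic_pullbackComplex_comp_iff _ _ K G).mp (h.pullbackComplex _))
  rw [hy'] at hO
  refine ⟨O, O.ι ≫ V.ι, inferInstance, ⟨⟨v, hO⟩, hv⟩, ?_⟩
  rw [← quasiIsomorphic_pullbackComplex_comp_iff]
  have : QuasiIso ((pullbackFunctor O.ι).map g) := by
    rw [quasiIso_iff_stalkComplex_map]
    exact fun z ↦ (quasiIso_stalkComplex_map_pullbackFunctor_map_iff_of_flat O.ι z g).mpr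
      (hgO _ z.2)
  exact @QuasiIsomorphic.of_quasiIso _ _ _ _ _ ((pullbackFunctor O.ι).map g) this

end AlgebraicGeometry.Scheme.Modules

open Scheme.Modules

theorem infinite_residueField_of_hom {X Y : Scheme.{u}} (f : Y ⟶ X) (y : Y)
    [Infinite (X.residueField (f y))] : Infinite (Y.residueField y) :=
  .of_injective (f.residueFieldMap y).hom (f.residueFieldMap y).hom.injective

theorem Scheme.exists_zariskiCover {X : Scheme.{u}} (P : ∀ U : Scheme.{u}, (U ⟶ X) → Prop)
    (h : ∀ x : X, ∃ (U : Scheme.{u}) (j : U ⟶ X), IsOpenImmersion j ∧ (∃ u, j u = x) ∧ P U j) :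
    ∃ 𝒰 : Scheme.Cover.{u} Scheme.zariskiPrecoverage X, ∀ i, P (𝒰.X i) (𝒰.f i) := by
  choose U j hj hu hP using h
  choose u hu using hu
  refine ⟨.mkOfCovers X U j (fun x ↦ ⟨x, u x, hu x⟩) hj, hP⟩

theorem IsPerfectComplex.isForm_zariski_of_isForm_fppf {X : Scheme.{u}} [IsLocallyNoetherian X]
    (hX : ∀ x : X, Infinite (X.residueField x)) {E F : CochainComplex X.Modules ℤ}
    (hE : IsPerfectComplex E) (hF : IsForm Scheme.fppfPrecoverage F E) :
    IsForm Scheme.zariskiPrecoverage F E := by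
  obtain ⟨𝒰, h𝒰⟩ := hE
  obtain ⟨𝒱, h𝒱⟩ := hF
  refine Scheme.exists_zariskiCover
    (fun U j ↦ QuasiIsomorphic (pullbackComplex j E) (pullbackComplex j F)) fun x ↦ ?_
  obtain ⟨i, y, rfl⟩ := 𝒰.exists_eq x
  have h𝒱' := (Scheme.presieve₀_mem_precoverage_iff 𝒱.toPreZeroHypercover
    (P := @Flat ⊓ @LocallyOfFinitePresentation)).mp 𝒱.mem₀
  obtain ⟨k, z, hz⟩ := h𝒱'.1 (𝒰.f i y)
  obtain ⟨K, hK, hK', α, _⟩ := h𝒰 i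
  have hKb : IsBoundedDual K := ⟨hK, fun j ↦ (hK' j).hasDualBasis⟩
  have hg : IsOpenImmersion (𝒰.f i) := 𝒰.map_prop i
  have := (h𝒱'.2 k).1
  have := (h𝒱'.2 k).2
  -- The fppf covering is pulled back to the chart on which `E` has a finite free model `K`, with
  -- `w` above the given point of the chart.
  obtain ⟨w, rfl, hw⟩ := Scheme.Pullback.exists_preimage_pullback y z hz.symm
  have := isLocallyNoetherian_of_isOpenImmersion (𝒰.f i)
  have := hX (𝒰.f i (Limits.pullback.fst (𝒰.f i) (𝒱.f k) w))
  have := infinite_residueField_of_hom (𝒰.f i) (Limits.pullback.fst (𝒰.f i) (𝒱.f k) w)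
  -- On the fibre product, `K` is quasi-isomorphic to `E` through the chart and `E` to `F` through
  -- the fppf covering.
  have hQ : QuasiIsomorphic (pullbackComplex (Limits.pullback.fst (𝒰.f i) (𝒱.f k)) K)
      (pullbackComplex (Limits.pullback.fst (𝒰.f i) (𝒱.f k)) (pullbackComplex (𝒰.f i) F)) := by
    refine ((QuasiIsomorphic.of_quasiIso α).pullbackComplex _).trans ?_
    rw [quasiIsomorphic_pullbackComplex_comp_iff, Limits.pullback.condition,
      ← quasiIsomorphic_pullbackComplex_comp_iff]
    exact (h𝒱 k).pullbackComplex _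
  obtain ⟨U, j, hj, ⟨u, hu⟩, h⟩ := hKb.exists_quasiIsomorphic_pullbackComplex _ w hQ
  refine ⟨U, j ≫ 𝒰.f i, inferInstance, ⟨u, congrArg (𝒰.f i) hu⟩, ?_⟩
  rw [← quasiIsomorphic_pullbackComplex_comp_iff]
  exact (((QuasiIsomorphic.of_quasiIso α).pullbackComplex j).symm).trans h

theorem mainTheorem1 :
    (∀ (R : Type u) [CommRing R] [IsLocalRing R] [IsNoetherianRing R]
        [Infinite (IsLocalRing.ResidueField R)]
        (S : Type v) [CommRing S] [Algebra R S] [Module.FaithfullyFlat R S]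
        (P Q : CochainComplex (ModuleCat.{u} R) ℤ),
        IsStrictlyPerfect P → IsStrictlyPerfect Q →
        QuasiIsomorphic (baseChangeComplex S P) (baseChangeComplex S Q) →
        QuasiIsomorphic P Q) ∧
    (∀ (X : Scheme.{u}) [IsNoetherian X] (_ : ∀ x : X, Infinite (X.residueField x))
        (E F : CochainComplex X.Modules ℤ),
        IsPerfectComplex E →
        IsForm Scheme.fppfPrecoverage F E →
        IsForm Scheme.zariskiPrecoverage F E) := by
  refine ⟨fun R _ _ _ _ S _ _ _ P Q hP _ h ↦ quasiIsomorphic_of_baseChangeComplex R S P Q hP h, ?_⟩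
  exact fun X _ hX E F hE hF ↦ hE.isForm_zariski_of_isForm_fppf hX hF

end
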